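/- **Setting.** Let $(M,g)$ be a connected, complete, smooth Riemannian manifold of dimension $n\ge 1$, with distance $\rho$. Write $B_x(r)=\{y\in M:\rho(x,y)<r\}$ for $r\in(0,+\infty]$, and let $i(x)\in(0,+\infty]$ be the injectivity radius at $x$: the largest $r$ for which $\exp_x:\{v\in T_xM:|v|<r\}\to B_x(r)$ is a diffeomorphism. Let $x^*\in M$ and let $D\subseteq B_{x^*}(i(x^*))$ be an open set containing $x^*$. Let $f$ assign to $(t,x)\in[0,+\infty)\times D$ a vector $f(t,x)\in T_xM$, continuous in $t$ and locally Lipschitz in $x$ (that is: for every $p\in D$ and $T>0$ there is a neighbourhood of $p$ in $D$ on which the coordinate expressions of $f(t,\cdot)$ in a chart at $p$ are Lipschitz with one constant for all $t\in[0,T]$), with $f(t,x^*)=0$ for all $t\ge 0$. Consider $$\dot x(t)=f(t,x(t)),\qquad t\ge t_0\ge 0 .\tag{1}$$ Put $r_0=\sup\{r>0: B_{x^*}(r)\subseteq D\}\in(0,+\infty]$. A function $W:D\to\mathbb R$ is positive definite (relative to $x^*$) if $W(x^*)=0$ and $W(x)>0$ for $x\in D\setminus\{x^*\}$. For $a\in(0,+\infty]$,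 a continuous $\beta:[0,a)\times[0,+\infty)\to[0,+\infty)$ is of class $\mathcal{KL}$ if $\beta(0,s)=0$ and $\beta(\cdot,s)$ is strictly increasing for every $s\ge 0$, and, for every $r\in[0,a)$, $\beta(r,\cdot)$ is nonincreasing with $\beta(r,s)\to 0$ as $s\to+\infty$. **Theorem.** Suppose there are a $C^1$ function $V:[0,+\infty)\times D\to\mathbb R$ and continuous positive definite functions $W_1,W_2,W_3:D\to\mathbb R$ such that, for all $(t,x)\in[0,+\infty)\times D$, $$W_1(x)\le V(t,x)\le W_2(x),\qquad V_t(t,x)+d_xV(t,x)(f(t,x))\le -W_3(x).$$ Say that $\beta$ is a bound on a set $S\subseteq D$ if for all $t_0\ge 0$ and $x_0\in S$ the system (1) has a solution in $D$ on $[t_0,+\infty)$ with $x(t_0)=x_0$, and every solution $x(\cdot)$ of (1) in $D$ with $x(t_0)=x_0$ satisfies $$\rho(x^*,x(t))\le\beta(\rho(x^*,x_0),t-t_0)$$ for all $t\ge t_0$ at which it is defined. Then: (i) For every $r\in(0,r_0)$ and every $c\in\bigl(0,\min_{\rho(x,x^*)=r}W_1(x)\bigr)$ there is a class $\mathcal{KL}$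 function $\beta$ on $[0,+\infty)\times[0,+\infty)$ that is a bound on $\{x\in\operatorname{cl}B_{x^*}(r): W_2(x)\le c\}$. (ii) If $W_1(x)\to+\infty$ as $\rho(x,x^*)\to r_0$, $x\in B_{x^*}(r_0)$, then there is a class $\mathcal{KL}$ function $\beta$ on $[0,r_0)\times[0,+\infty)$ that is a bound on $B_{x^*}(r_0)$. (iii) If $r_0<+\infty$, $\dfrac{W_1(x)}{r_0^2-\rho^2(x,x^*)}\to+\infty$ as $\rho(x,x^*)\to r_0$, $x\in B_{x^*}(r_0)$, and $d_x\rho^2(x,x^*)(f(t,x))\le 0$ for all $(t,x)\in[0,+\infty)\times B_{x^*}(r_0)$, then there is a class $\mathcal{KL}$ function $\beta$ on $[0,r_0)\times[0,+\infty)$ that is a bound on $B_{x^*}(r_0)$. -/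

import Mathlib

open Set Filter Topology Manifold Bundle
open scoped ENNReal ContDiff

noncomputable section

section Riemannian

variable {n : ℕ} {M : Type*} [MetricSpace M] [ChartedSpace (EuclideanSpace ℝ (Fin n)) M]
  [RiemannianBundle (fun x : M => TangentSpace (𝓡 n) x)]

/-- The Riemannian metric in the preferred chart at `p`: `g_u(v, w)`, for `u` in the target of the
chart and coordinate vectors `v`, `w`. -/
def chartMetric (p : M) (u v w : EuclideanSpace ℝ (Fin n)) : ℝ :=
  inner ℝ (mfderiv 𝓘(ℝ, EuclideanSpace ℝ (Fin n)) (𝓡 n) (extChartAt (𝓡 n) p).symm u v)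
    (mfderiv 𝓘(ℝ, EuclideanSpace ℝ (Fin n)) (𝓡 n) (extChartAt (𝓡 n) p).symm u w)

/-- The Christoffel symbols (of the first kind) of the Levi-Civita connection in the preferred
chart at `p`, i.e. `g_u(∇_v w, z)` for constant coordinate fields `v`, `w`, `z`:
`(∂_v g(w, z) + ∂_w g(v, z) - ∂_z g(v, w)) / 2`. -/
def chartChristoffel (p : M) (u v w z : EuclideanSpace ℝ (Fin n)) : ℝ :=
  (fderiv ℝ (fun y => chartMetric p y w z) u v
    + fderiv ℝ (fun y => chartMetric p y v z) u w
    - fderiv ℝ (fun y => chartMetric p y v w) u z) / 2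

variable (n) in
/-- `γ : ℝ → M` is a geodesic of the Levi-Civita connection: it is smooth and `∇_{γ'} γ' = 0`.
In a chart, with `c` the coordinate expression of `γ`, this is
`g_c(c'', z) + g_c(∇_{c'} c', z) = 0` for every `z`, the second term being the Christoffel one. -/
def IsGeodesic (γ : ℝ → M) : Prop :=
  ContMDiff 𝓘(ℝ, ℝ) (𝓡 n) ∞ γ ∧
  ∀ (p : M) (t : ℝ), γ t ∈ (extChartAt (𝓡 n) p).source → ∀ z : EuclideanSpace ℝ (Fin n),
    chartMetric p (extChartAt (𝓡 n) p (γ t))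
        (deriv (deriv fun s => extChartAt (𝓡 n) p (γ s)) t) z
      + chartChristoffel p (extChartAt (𝓡 n) p (γ t))
        (deriv (fun s => extChartAt (𝓡 n) p (γ s)) t)
        (deriv (fun s => extChartAt (𝓡 n) p (γ s)) t) z = 0

/-- `γ` is a geodesic with `γ 0 = x` and `γ' 0 = v`. -/
def IsGeodesicFrom {x : M} (v : TangentSpace (𝓡 n) x) (γ : ℝ → M) : Prop :=
  IsGeodesic n γ ∧
    (⟨γ 0, mfderiv 𝓘(ℝ, ℝ) (𝓡 n) γ 0 (1 : ℝ)⟩ : TangentBundle (𝓡 n) M) = ⟨x, v⟩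

open Classical in
/-- The exponential map `exp_x v = γ 1`, with `γ` the geodesic such that `γ 0 = x`, `γ' 0 = v`.
On a complete manifold `γ` always exists and is unique, so the default value is never used. -/
def expMap (x : M) (v : TangentSpace (𝓡 n) x) : M :=
  if h : ∃ γ : ℝ → M, IsGeodesicFrom v γ then h.choose 1 else x

variable (n) in
/-- `exp_x` restricts to a diffeomorphism from `{v ∈ T_x M : |v| < r}` onto `B_x(r)`, with
inverse `g`. The norm of `T_x M` is the one of the Riemannian metric. -/
def ExpDiffeoOnBall (x : M) (r : ℝ) : Prop :=
  BijOn (expMap (n := n) x) (Metric.ball 0 r) (Metric.ball x r) ∧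
  ContMDiffOn 𝓘(ℝ, TangentSpace (𝓡 n) x) (𝓡 n) ∞ (expMap (n := n) x) (Metric.ball 0 r) ∧
  ∃ g : M → TangentSpace (𝓡 n) x,
    LeftInvOn g (expMap x) (Metric.ball 0 r) ∧
    ContMDiffOn (𝓡 n) 𝓘(ℝ, TangentSpace (𝓡 n) x) ∞ g (Metric.ball x r)

variable (n) in
/-- The injectivity radius `i(x) ∈ [0, ∞]`. -/
def injectivityRadius (x : M) : ℝ≥0∞ :=
  ⨆ (r : ℝ) (_ : 0 < r ∧ ExpDiffeoOnBall n x r), ENNReal.ofReal r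

end Riemannian

/-- `sup {r > 0 : B_x(r) ⊆ D} ∈ [0, ∞]`. -/
def inradiusAt {M : Type*} [MetricSpace M] (x : M) (D : Set M) : ℝ≥0∞ :=
  ⨆ (r : ℝ) (_ : 0 < r ∧ Metric.ball x r ⊆ D), ENNReal.ofReal r

/-- A continuous function that is positive definite on `D` relative to `x`. -/
def IsContPosDefOn {M : Type*} [MetricSpace M] (W : M → ℝ) (x : M) (D : Set M) : Prop :=
  ContinuousOn W D ∧ W x = 0 ∧ ∀ y ∈ D, y ≠ x → 0 < W y

/-- The interval `[0, a)` for `a ∈ [0, ∞]`. -/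
def halfOpenFromZero (a : ℝ≥0∞) : Set ℝ := {s | 0 ≤ s ∧ ENNReal.ofReal s < a}

/-- Class `K` on `[0, a)`. -/
def IsClassK (a : ℝ≥0∞) (α : ℝ → ℝ) : Prop :=
  ContinuousOn α (halfOpenFromZero a) ∧ StrictMonoOn α (halfOpenFromZero a) ∧ α 0 = 0

/-- Class `KL` on `[0, a) × [0, ∞)`. -/
def IsClassKL (a : ℝ≥0∞) (β : ℝ → ℝ → ℝ) : Prop :=
  ContinuousOn (Function.uncurry β) (halfOpenFromZero a ×ˢ Ici 0) ∧
  (∀ s, 0 ≤ s → IsClassK a fun r => β r s) ∧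
  ∀ r ∈ halfOpenFromZero a, AntitoneOn (β r) (Ici 0) ∧ Tendsto (β r) atTop (𝓝 0)

section System

variable {n : ℕ} {M : Type*} [MetricSpace M] [ChartedSpace (EuclideanSpace ℝ (Fin n)) M]

/-- `f : [0, ∞) × D → TM` is continuous in `t` and locally Lipschitz in `x`. The latter is expressed
in charts, with a Lipschitz constant that is uniform for `t` in compact intervals. -/
def IsContLocLipschitz (f : ℝ → (x : M) → TangentSpace (𝓡 n) x) (D : Set M) : Prop :=
  (∀ x ∈ D, ContinuousOn (fun t => f t x) (Ici 0)) ∧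
  ∀ p ∈ D, ∀ T : ℝ, ∃ L : ℝ, ∃ U ∈ 𝓝 p, U ⊆ (extChartAt (𝓡 n) p).source ∧ U ⊆ D ∧
    ∀ t ∈ Icc 0 T, ∀ x ∈ U, ∀ y ∈ U,
      ‖mvfderiv (𝓡 n) (extChartAt (𝓡 n) p) x (f t x)
        - mvfderiv (𝓡 n) (extChartAt (𝓡 n) p) y (f t y)‖
        ≤ L * ‖extChartAt (𝓡 n) p x - extChartAt (𝓡 n) p y‖

/-- `x` solves `x' = f(t, x)` on the interval `J`, with values in `D`
(the derivative is one-sided at an end point of `J`). -/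
def IsSolutionOn (f : ℝ → (x : M) → TangentSpace (𝓡 n) x) (D : Set M) (x : ℝ → M)
    (J : Set ℝ) : Prop :=
  ∀ t ∈ J, x t ∈ D ∧
    HasMFDerivWithinAt 𝓘(ℝ, ℝ) (𝓡 n) x J t
      ((1 : ℝ →L[ℝ] ℝ).smulRight (f t (x t)))

/-- For all `t₀ ≥ 0` and `x₀ ∈ S`, there is a solution starting at `x₀` at time `t₀` and defined on
`[t₀, ∞)`, and every solution starting there obeys `ρ(x*, x(t)) ≤ β(ρ(x*, x₀), t - t₀)` as long as
it is defined. -/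
def HasKLBoundFrom (f : ℝ → (x : M) → TangentSpace (𝓡 n) x) (D : Set M) (xs : M) (S : Set M)
    (β : ℝ → ℝ → ℝ) : Prop :=
  ∀ t₀ : ℝ, 0 ≤ t₀ → ∀ x₀ ∈ S,
    (∃ x : ℝ → M, IsSolutionOn f D x (Ici t₀) ∧ x t₀ = x₀) ∧
    ∀ (T : ℝ) (x : ℝ → M), IsSolutionOn f D x (Ico t₀ T) → x t₀ = x₀ →
      ∀ t ∈ Ico t₀ T, dist xs (x t) ≤ β (dist xs x₀) (t - t₀)

/-- `V : [0, ∞) × D → ℝ` is `C¹`, lies between `W₁` and `W₂`, and its derivative along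
`x' = f(t, x)` is at most `-W₃`. -/
structure IsLyapunov (f : ℝ → (x : M) → TangentSpace (𝓡 n) x) (D : Set M)
    (V : ℝ → M → ℝ) (W₁ W₂ W₃ : M → ℝ) : Prop where
  contMDiffOn : ContMDiffOn (𝓘(ℝ, ℝ).prod (𝓡 n)) 𝓘(ℝ, ℝ) 1
    (fun q : ℝ × M => V q.1 q.2) (Ici 0 ×ˢ D)
  lower : ∀ t, 0 ≤ t → ∀ x ∈ D, W₁ x ≤ V t x
  upper : ∀ t, 0 ≤ t → ∀ x ∈ D, V t x ≤ W₂ x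
  decay : ∀ t, 0 ≤ t → ∀ x ∈ D,
    derivWithin (fun s => V s x) (Ici 0) t
      + mvfderiv (𝓡 n) (V t) x (f t x) ≤ -W₃ x

end System

/-- The filter `ρ(x, x*) → r₀`, `x ∈ B_{x*}(r₀)`, for `r₀ ∈ [0, ∞]`. -/
def nearBoundary {M : Type*} [MetricSpace M] (xs : M) (r₀ : ℝ≥0∞) : Filter M :=
  comap (fun x => edist x xs) (𝓝 r₀) ⊓ 𝓟 (Metric.eball xs r₀)

end

open scoped NNReal

set_option synthInstance.maxHeartbeats 400000

section ChartMetric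

variable {n : ℕ} {M : Type*} [MetricSpace M] [ChartedSpace (EuclideanSpace ℝ (Fin n)) M]

/-- The derivative of the inverse of the preferred chart at `p`, as a linear map on the model. -/
noncomputable def chartFrame (p : M) (u : EuclideanSpace ℝ (Fin n)) :
    EuclideanSpace ℝ (Fin n) →L[ℝ] TangentSpace (𝓡 n) ((extChartAt (𝓡 n) p).symm u) :=
  mfderiv 𝓘(ℝ, EuclideanSpace ℝ (Fin n)) (𝓡 n) (extChartAt (𝓡 n) p).symm u

section Algebra

variable [RiemannianBundle (fun x : M => TangentSpace (𝓡 n) x)]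

theorem chartMetric_eq (p : M) (u v w : EuclideanSpace ℝ (Fin n)) :
    chartMetric p u v w = inner ℝ (chartFrame p u v) (chartFrame p u w) := rfl

theorem chartMetric_symm (p : M) (u v w : EuclideanSpace ℝ (Fin n)) :
    chartMetric p u v w = chartMetric p u w v := real_inner_comm _ _

/-- The Riemannian metric in the preferred chart at `p` as a continuous bilinear form. -/
noncomputable def chartGram (p : M) (u : EuclideanSpace ℝ (Fin n)) :
    EuclideanSpace ℝ (Fin n) →L[ℝ] EuclideanSpace ℝ (Fin n) →L[ℝ] ℝ :=
  (innerSL ℝ).bilinearComp (chartFrame p u) (chartFrame p u)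

theorem chartGram_apply (p : M) (u v w : EuclideanSpace ℝ (Fin n)) :
    chartGram p u v w = chartMetric p u v w := rfl

end Algebra

variable [IsManifold (𝓡 n) ∞ M]

theorem contMDiffOn_mfderiv_extChartAt_symm (p : M) (v : EuclideanSpace ℝ (Fin n)) :
    ContMDiffOn 𝓘(ℝ, EuclideanSpace ℝ (Fin n)) (𝓡 n).tangent ∞
      (fun u => (⟨(extChartAt (𝓡 n) p).symm u,
        mfderiv 𝓘(ℝ, EuclideanSpace ℝ (Fin n)) (𝓡 n) (extChartAt (𝓡 n) p).symm u v⟩ :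
          TangentBundle (𝓡 n) M)) (extChartAt (𝓡 n) p).target := by
  have hopen : IsOpen (extChartAt (𝓡 n) p).target := isOpen_extChartAt_target p
  have h1 : ContMDiffOn 𝓘(ℝ, EuclideanSpace ℝ (Fin n)) (𝓡 n) ∞ (extChartAt (𝓡 n) p).symm
      (extChartAt (𝓡 n) p).target := contMDiffOn_extChartAt_symm p
  have h2 := h1.contMDiffOn_tangentMapWithin (m := ∞) (by simp) hopen.uniqueMDiffOn
  have h3 : ContMDiff 𝓘(ℝ, EuclideanSpace ℝ (Fin n)) (𝓘(ℝ, EuclideanSpace ℝ (Fin n))).tangent ∞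
      (fun u : EuclideanSpace ℝ (Fin n) =>
        (⟨u, v⟩ : TangentBundle 𝓘(ℝ, EuclideanSpace ℝ (Fin n)) (EuclideanSpace ℝ (Fin n)))) := by
    exact contMDiff_vectorSpace_iff_contDiff.2 (contDiff_const (c := v))
  refine (h2.comp h3.contMDiffOn (fun u hu => hu)).congr fun u hu => ?_
  simp only [tangentMapWithin, Function.comp]
  rw [mfderivWithin_of_isOpen hopen hu]

theorem chartFrame_injective (p : M) {u : EuclideanSpace ℝ (Fin n)}
    (hu : u ∈ (extChartAt (𝓡 n) p).target) :
    Function.Injective (chartFrame p u) := by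
  have h := isInvertible_mfderivWithin_extChartAt_symm (I := 𝓡 n) hu
  have h' : (mfderivWithin 𝓘(ℝ, EuclideanSpace ℝ (Fin n)) (𝓡 n) (extChartAt (𝓡 n) p).symm
    (range (𝓡 n)) u).IsInvertible := h
  rw [ModelWithCorners.range_eq_univ, mfderivWithin_univ] at h'
  exact h'.injective

variable [RiemannianBundle (fun x : M => TangentSpace (𝓡 n) x)]

theorem chartMetric_self_eq_zero (p : M) {u v : EuclideanSpace ℝ (Fin n)}
    (hu : u ∈ (extChartAt (𝓡 n) p).target) (h : chartMetric p u v v = 0) : v = 0 := by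
  have h1 := inner_self_eq_zero.1 h
  exact chartFrame_injective p hu (h1.trans (map_zero _).symm)


variable [IsContMDiffRiemannianBundle (𝓡 n) ∞ (EuclideanSpace ℝ (Fin n))
  (fun x : M => TangentSpace (𝓡 n) x)]

theorem contDiffOn_chartMetric (p : M) (v w : EuclideanSpace ℝ (Fin n)) :
    ContDiffOn ℝ ∞ (fun u => chartMetric p u v w) (extChartAt (𝓡 n) p).target := by
  rw [← contMDiffOn_iff_contDiffOn]
  exact (contMDiffOn_mfderiv_extChartAt_symm p v).inner_bundle
    (contMDiffOn_mfderiv_extChartAt_symm p w)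

theorem contDiffOn_chartGram (p : M) :
    ContDiffOn ℝ ∞ (chartGram p) (extChartAt (𝓡 n) p).target :=
  contDiffOn_clm_apply.2 fun v => contDiffOn_clm_apply.2 fun w => contDiffOn_chartMetric p v w

theorem contDiffAt_chartGram (p : M) {u : EuclideanSpace ℝ (Fin n)}
    (hu : u ∈ (extChartAt (𝓡 n) p).target) : ContDiffAt ℝ ∞ (chartGram p) u :=
  (contDiffOn_chartGram p).contDiffAt ((isOpen_extChartAt_target p).mem_nhds hu)

theorem fderiv_chartMetric (p : M) {u : EuclideanSpace ℝ (Fin n)}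
    (hu : u ∈ (extChartAt (𝓡 n) p).target) (v w z : EuclideanSpace ℝ (Fin n)) :
    fderiv ℝ (fun y => chartMetric p y v w) u z = fderiv ℝ (chartGram p) u z v w := by
  have h : HasFDerivAt (chartGram (n := n) p) (fderiv ℝ (chartGram (n := n) p) u) u :=
    ((contDiffAt_chartGram p hu).differentiableAt (by simp)).hasFDerivAt
  have h2 := (h.clm_apply (hasFDerivAt_const v u)).clm_apply (hasFDerivAt_const w u)
  have h3 : fderiv ℝ (fun y => chartMetric p y v w) u = _ := h2.fderiv
  rw [h3]
  simp

theorem chartChristoffel_self (p : M) {u : EuclideanSpace ℝ (Fin n)}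
    (hu : u ∈ (extChartAt (𝓡 n) p).target) (v z : EuclideanSpace ℝ (Fin n)) :
    chartChristoffel p u v v z
      = fderiv ℝ (chartGram p) u v v z - fderiv ℝ (chartGram p) u z v v / 2 := by
  simp only [chartChristoffel, fderiv_chartMetric p hu]
  ring

end ChartMetric

section BilinearODE

variable {E : Type*} [NormedAddCommGroup E] [NormedSpace ℝ E]

/-- The covector `z ↦ Γ(v, v, z)` of Christoffel symbols of a metric `G` on a vector space. -/
noncomputable def christoffelForm (G : E → E →L[ℝ] E →L[ℝ] ℝ) (q : E × E) : E →L[ℝ] ℝ :=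
  fderiv ℝ G q.1 q.2 q.2 - (2⁻¹ : ℝ) • ((fderiv ℝ G q.1).flip q.2).flip q.2

theorem christoffelForm_apply (G : E → E →L[ℝ] E →L[ℝ] ℝ) (q : E × E) (z : E) :
    christoffelForm G q z = fderiv ℝ G q.1 q.2 q.2 z - fderiv ℝ G q.1 z q.2 q.2 / 2 := by
  simp [christoffelForm, div_eq_inv_mul]

/-- The geodesic vector field of a metric `G` on the phase space `E × E`. -/
noncomputable def geodesicField (G : E → E →L[ℝ] E →L[ℝ] ℝ) (q : E × E) : E × E :=
  (q.2, (G q.1).inverse (-christoffelForm G q))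

theorem contDiffOn_fderiv_fst_apply {F : Type*} [NormedAddCommGroup F] [NormedSpace ℝ F]
    {G : E → F} {U : Set E} (hU : IsOpen U) (hG : ContDiffOn ℝ ∞ G U) {b : E × E → E}
    (hb : ContDiff ℝ 1 b) : ContDiffOn ℝ 1 (fun q : E × E => fderiv ℝ G q.1 (b q)) (U ×ˢ univ) :=
  (((hG.fderiv_of_isOpen hU (m := 1) (by norm_cast)).comp contDiffOn_fst fun _ hq => hq.1)).clm_apply
    hb.contDiffOn

variable [FiniteDimensional ℝ E]

theorem contDiffOn_christoffelForm {G : E → E →L[ℝ] E →L[ℝ] ℝ} {U : Set E} (hU : IsOpen U)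
    (hG : ContDiffOn ℝ ∞ G U) : ContDiffOn ℝ 1 (christoffelForm G) (U ×ˢ univ) := by
  refine contDiffOn_clm_apply.2 fun z => ?_
  simp only [christoffelForm_apply]
  have h1 : ContDiffOn ℝ 1 (fun q : E × E => fderiv ℝ G q.1 q.2 q.2) (U ×ˢ univ) :=
    (contDiffOn_fderiv_fst_apply hU hG contDiff_snd).clm_apply contDiffOn_snd
  have h2 : ContDiffOn ℝ 1 (fun q : E × E => fderiv ℝ G q.1 z q.2) (U ×ˢ univ) :=
    (contDiffOn_fderiv_fst_apply hU hG contDiff_const).clm_apply contDiffOn_snd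
  exact (h1.clm_apply contDiffOn_const).sub ((h2.clm_apply contDiffOn_snd).div_const 2)

theorem isInvertible_of_injective_dual {A : E →L[ℝ] E →L[ℝ] ℝ} (hA : Function.Injective A) :
    A.IsInvertible := by
  have e0 : Module.finrank ℝ (E →L[ℝ] ℝ) = Module.finrank ℝ E := by
    rw [← (LinearMap.toContinuousLinearMap : (E →ₗ[ℝ] ℝ) ≃ₗ[ℝ] _).finrank_eq]
    exact Subspace.dual_finrank_eq
  let e := (LinearEquiv.ofInjectiveOfFinrankEq (A : E →ₗ[ℝ] E →L[ℝ] ℝ) hA e0.symm)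
  refine ⟨e.toContinuousLinearEquiv, ?_⟩
  ext v w
  rfl

theorem contDiffAt_geodesicField {G : E → E →L[ℝ] E →L[ℝ] ℝ} {U : Set E} (hU : IsOpen U)
    (hG : ContDiffOn ℝ ∞ G U) (hinj : ∀ u ∈ U, Function.Injective (G u)) {q : E × E}
    (hq : q.1 ∈ U) : ContDiffAt ℝ 1 (geodesicField G) q := by
  obtain ⟨e, he⟩ := isInvertible_of_injective_dual (hinj _ hq)
  have h1 : ContDiffAt ℝ 1 (fun q : E × E => (G q.1).inverse) q := by
    have h := contDiffAt_map_inverse (n := 1) e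
    rw [he] at h
    refine h.comp q (ContDiffAt.comp q ?_ contDiffAt_fst)
    exact (hG.contDiffAt (hU.mem_nhds hq)).of_le (by norm_cast)
  refine contDiffAt_snd.prodMk (h1.clm_apply ?_)
  exact ((contDiffOn_christoffelForm hU hG).contDiffAt
    ((hU.prod isOpen_univ).mem_nhds ⟨hq, mem_univ _⟩)).neg

theorem hasDerivAt_geodesicField {G : E → E →L[ℝ] E →L[ℝ] ℝ} {c : ℝ → E} {t : ℝ}
    (hinj : Function.Injective (G (c t))) (hc : DifferentiableAt ℝ c t)
    (hc' : DifferentiableAt ℝ (deriv c) t)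
    (h : ∀ z, G (c t) (deriv (deriv c) t) z + christoffelForm G (c t, deriv c t) z = 0) :
    HasDerivAt (fun s => (c s, deriv c s)) (geodesicField G (c t, deriv c t)) t := by
  have key : (G (c t)).inverse (-christoffelForm G (c t, deriv c t)) = deriv (deriv c) t := by
    rw [(isInvertible_of_injective_dual hinj).inverse_apply_eq]
    ext z
    have := h z
    simp only [neg_apply]
    linarith
  rw [geodesicField, key]
  exact hc.hasDerivAt.prodMk hc'.hasDerivAt

theorem eventuallyEq_of_geodesic_equation {G : E → E →L[ℝ] E →L[ℝ] ℝ} {U : Set E} (hU : IsOpen U)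
    (hG : ContDiffOn ℝ ∞ G U) (hinj : ∀ u ∈ U, Function.Injective (G u)) {c₁ c₂ : ℝ → E} {t₀ : ℝ}
    (hu : c₁ t₀ ∈ U) (h₁ : ContDiffAt ℝ 2 c₁ t₀) (h₂ : ContDiffAt ℝ 2 c₂ t₀)
    (e₁ : ∀ᶠ t in 𝓝 t₀, ∀ z, G (c₁ t) (deriv (deriv c₁) t) z
      + christoffelForm G (c₁ t, deriv c₁ t) z = 0)
    (e₂ : ∀ᶠ t in 𝓝 t₀, ∀ z, G (c₂ t) (deriv (deriv c₂) t) z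
      + christoffelForm G (c₂ t, deriv c₂ t) z = 0)
    (h0 : c₁ t₀ = c₂ t₀) (h0' : deriv c₁ t₀ = deriv c₂ t₀) : c₁ =ᶠ[𝓝 t₀] c₂ := by
  obtain ⟨K, s, hs, hK⟩ := (contDiffAt_geodesicField hU hG hinj
    (q := (c₁ t₀, deriv c₁ t₀)) hu).exists_lipschitzOnWith
  have aux : ∀ c : ℝ → E, c t₀ = c₁ t₀ → deriv c t₀ = deriv c₁ t₀ → ContDiffAt ℝ 2 c t₀ →
      (∀ᶠ t in 𝓝 t₀, ∀ z, G (c t) (deriv (deriv c) t) z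
        + christoffelForm G (c t, deriv c t) z = 0) →
      ∀ᶠ t in 𝓝 t₀, HasDerivAt (fun s => (c s, deriv c s)) (geodesicField G (c t, deriv c t)) t
        ∧ (c t, deriv c t) ∈ s := by
    intro c hc hc' hd he
    have hd2 : ∀ᶠ t in 𝓝 t₀, ContDiffAt ℝ 2 c t := hd.eventually (by simp)
    have hder : ∀ t, ContDiffAt ℝ 2 c t → DifferentiableAt ℝ (deriv c) t := fun t ht =>
      ((ht.fderiv_right (m := 1) (by norm_num)).clm_apply
        (contDiffAt_const (c := (1 : ℝ)))).differentiableAt (by simp)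
    have hcont : ContinuousAt (fun s => (c s, deriv c s)) t₀ :=
      hd.continuousAt.prodMk (hder _ hd).continuousAt
    have hU' : ∀ᶠ t in 𝓝 t₀, c t ∈ U := hd.continuousAt.preimage_mem_nhds (by
      rw [hc]; exact hU.mem_nhds hu)
    have hs' : ∀ᶠ t in 𝓝 t₀, (c t, deriv c t) ∈ s := hcont.preimage_mem_nhds (by
      simp only [hc, hc']; exact hs)
    filter_upwards [hd2, he, hU', hs'] with t h1 h2 h3 h4
    exact ⟨hasDerivAt_geodesicField (hinj _ h3) (h1.differentiableAt (by simp)) (hder _ h1) h2, h4⟩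
  have := ODE_solution_unique_of_eventually (v := fun _ => geodesicField G) (s := fun _ => s)
    (Eventually.of_forall fun _ => hK) (aux c₁ rfl rfl h₁ e₁) (aux c₂ h0.symm h0'.symm h₂ e₂)
    (by simp [h0, h0'])
  filter_upwards [this] with t ht
  exact (Prod.ext_iff.1 ht).1

end BilinearODE

section Geodesic

theorem ContDiffAt.continuousAt_deriv_of_infty {F : Type*} [NormedAddCommGroup F] [NormedSpace ℝ F]
    {c : ℝ → F} {t : ℝ} (h : ContDiffAt ℝ ∞ c t) : ContinuousAt (deriv c) t :=
  ((h.fderiv_right (m := 1) (by norm_cast)).clm_apply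
    (contDiffAt_const (c := (1 : ℝ)))).continuousAt


variable {n : ℕ} {M : Type*} [MetricSpace M] [ChartedSpace (EuclideanSpace ℝ (Fin n)) M]

section

variable [RiemannianBundle (fun x : M => TangentSpace (𝓡 n) x)]

theorem IsGeodesic.eventually_mem_source {γ : ℝ → M} (hγ : IsGeodesic n γ) (p : M) {t : ℝ}
    (ht : γ t ∈ (extChartAt (𝓡 n) p).source) :
    ∀ᶠ s in 𝓝 t, γ s ∈ (extChartAt (𝓡 n) p).source :=
  hγ.1.continuous.continuousAt.preimage_mem_nhds ((isOpen_extChartAt_source p).mem_nhds ht)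

end

variable [IsManifold (𝓡 n) ∞ M]

theorem chartFrame_mvfderiv_extChartAt (p : M) {u : EuclideanSpace ℝ (Fin n)}
    (hu : u ∈ (extChartAt (𝓡 n) p).target)
    (X : TangentSpace (𝓡 n) ((extChartAt (𝓡 n) p).symm u)) :
    chartFrame p u (mvfderiv (𝓡 n) (extChartAt (𝓡 n) p) ((extChartAt (𝓡 n) p).symm u) X) = X := by
  have h : (mfderivWithin 𝓘(ℝ, EuclideanSpace ℝ (Fin n)) (𝓡 n) (extChartAt (𝓡 n) p).symm
      (range (𝓡 n)) u).comp (mfderiv (𝓡 n) 𝓘(ℝ, EuclideanSpace ℝ (Fin n)) (extChartAt (𝓡 n) p)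
        ((extChartAt (𝓡 n) p).symm u)) = ContinuousLinearMap.id ℝ _ :=
    mfderivWithin_extChartAt_symm_comp_mfderiv_extChartAt hu
  rw [ModelWithCorners.range_eq_univ, mfderivWithin_univ] at h
  exact DFunLike.congr_fun h X

theorem fderiv_extChartAt_comp {F : Type*} [NormedAddCommGroup F] [NormedSpace ℝ F] (p : M)
    {f : F → M} {q : F} (hf : MDifferentiableAt 𝓘(ℝ, F) (𝓡 n) f q)
    (hq : f q ∈ (extChartAt (𝓡 n) p).source) (a : F) :
    fderiv ℝ (fun y => extChartAt (𝓡 n) p (f y)) q a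
      = mvfderiv (𝓡 n) (extChartAt (𝓡 n) p) (f q) (mfderiv 𝓘(ℝ, F) (𝓡 n) f q a) := by
  have h1 : MDifferentiableAt (𝓡 n) 𝓘(ℝ, EuclideanSpace ℝ (Fin n)) (extChartAt (𝓡 n) p) (f q) :=
    mdifferentiableAt_extChartAt (by simpa using hq)
  have h := mfderiv_comp q h1 hf
  rw [mfderiv_eq_fderiv] at h
  exact DFunLike.congr_fun h a

/-- The derivative of a chart at `p`, as a function on the tangent bundle. -/
noncomputable def chartVelocity (p : M) (z : TangentBundle (𝓡 n) M) : EuclideanSpace ℝ (Fin n) :=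
  mvfderiv (𝓡 n) (extChartAt (𝓡 n) p) z.1 z.2

theorem deriv_extChartAt_comp (p : M) {γ : ℝ → M} {t : ℝ}
    (hγ : MDifferentiableAt 𝓘(ℝ, ℝ) (𝓡 n) γ t) (ht : γ t ∈ (extChartAt (𝓡 n) p).source) :
    deriv (fun s => extChartAt (𝓡 n) p (γ s)) t
      = chartVelocity p ⟨γ t, mfderiv 𝓘(ℝ, ℝ) (𝓡 n) γ t (1 : ℝ)⟩ := by
  rw [← fderiv_apply_one_eq_deriv]
  exact fderiv_extChartAt_comp p hγ ht 1

variable [RiemannianBundle (fun x : M => TangentSpace (𝓡 n) x)]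

theorem inner_eq_chartMetric (p : M) {y : M} (hy : y ∈ (extChartAt (𝓡 n) p).source)
    (X Y : TangentSpace (𝓡 n) y) :
    inner ℝ X Y = chartMetric p (extChartAt (𝓡 n) p y) (mvfderiv (𝓡 n) (extChartAt (𝓡 n) p) y X)
      (mvfderiv (𝓡 n) (extChartAt (𝓡 n) p) y Y) := by
  obtain ⟨u, hu, rfl⟩ : ∃ u ∈ (extChartAt (𝓡 n) p).target, (extChartAt (𝓡 n) p).symm u = y :=
    ⟨_, (extChartAt (𝓡 n) p).map_source hy, (extChartAt (𝓡 n) p).left_inv hy⟩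
  rw [(extChartAt (𝓡 n) p).right_inv hu, chartMetric_eq, chartFrame_mvfderiv_extChartAt p hu,
    chartFrame_mvfderiv_extChartAt p hu]

theorem chartGram_injective (p : M) {u : EuclideanSpace ℝ (Fin n)}
    (hu : u ∈ (extChartAt (𝓡 n) p).target) : Function.Injective (chartGram p u) := by
  rw [injective_iff_map_eq_zero]
  intro v hv
  exact chartMetric_self_eq_zero p hu (by rw [← chartGram_apply, hv]; rfl)

theorem IsGeodesic.contDiffAt_extChartAt {γ : ℝ → M} (hγ : IsGeodesic n γ) (p : M) {t : ℝ}
    (ht : γ t ∈ (extChartAt (𝓡 n) p).source) :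
    ContDiffAt ℝ ∞ (fun s => extChartAt (𝓡 n) p (γ s)) t := by
  rw [← contMDiffAt_iff_contDiffAt]
  exact (contMDiffAt_extChartAt' (by simpa using ht)).comp t hγ.1.contMDiffAt

variable [IsContMDiffRiemannianBundle (𝓡 n) ∞ (EuclideanSpace ℝ (Fin n))
  (fun x : M => TangentSpace (𝓡 n) x)]

theorem IsGeodesic.chartGram_equation {γ : ℝ → M} (hγ : IsGeodesic n γ) (p : M) {t : ℝ}
    (ht : γ t ∈ (extChartAt (𝓡 n) p).source) (z : EuclideanSpace ℝ (Fin n)) :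
    chartGram p (extChartAt (𝓡 n) p (γ t))
        (deriv (deriv fun s => extChartAt (𝓡 n) p (γ s)) t) z
      + christoffelForm (chartGram p) (extChartAt (𝓡 n) p (γ t),
          deriv (fun s => extChartAt (𝓡 n) p (γ s)) t) z = 0 := by
  have h := hγ.2 p t ht z
  rw [chartChristoffel_self p ((extChartAt (𝓡 n) p).map_source ht)] at h
  rw [christoffelForm_apply, chartGram_apply]
  exact h

theorem IsGeodesic.eventuallyEq {γ σ : ℝ → M} (hγ : IsGeodesic n γ) (hσ : IsGeodesic n σ) (p : M)
    {t : ℝ} (ht : γ t ∈ (extChartAt (𝓡 n) p).source) (h : γ t = σ t)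
    (h' : deriv (fun s => extChartAt (𝓡 n) p (γ s)) t
      = deriv (fun s => extChartAt (𝓡 n) p (σ s)) t) : γ =ᶠ[𝓝 t] σ := by
  have ht' : σ t ∈ (extChartAt (𝓡 n) p).source := h ▸ ht
  have key := eventuallyEq_of_geodesic_equation (isOpen_extChartAt_target p)
    (contDiffOn_chartGram p) (fun u hu => chartGram_injective p hu)
    (c₁ := fun s => extChartAt (𝓡 n) p (γ s)) (c₂ := fun s => extChartAt (𝓡 n) p (σ s)) (t₀ := t)
    ((extChartAt (𝓡 n) p).map_source ht)
    ((hγ.contDiffAt_extChartAt p ht).of_le (by norm_cast))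
    ((hσ.contDiffAt_extChartAt p ht').of_le (by norm_cast))
    ((hγ.eventually_mem_source p ht).mono fun s hs => hγ.chartGram_equation p hs)
    ((hσ.eventually_mem_source p ht').mono fun s hs => hσ.chartGram_equation p hs)
    (by simp only [h]) h'
  filter_upwards [key, hγ.eventually_mem_source p ht, hσ.eventually_mem_source p ht']
    with s h1 h2 h3
  exact (extChartAt (𝓡 n) p).injOn h2 h3 h1

theorem IsGeodesic.eq_of_eventuallyEq {γ σ : ℝ → M} (hγ : IsGeodesic n γ) (hσ : IsGeodesic n σ)
    {t₀ : ℝ} (h : γ =ᶠ[𝓝 t₀] σ) : γ = σ := by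
  have hopen : IsOpen {t | γ =ᶠ[𝓝 t] σ} :=
    isOpen_iff_mem_nhds.2 fun t ht => (eventually_eventually_nhds.2 ht)
  have hclosed : IsClosed {t | γ =ᶠ[𝓝 t] σ} := by
    refine isClosed_of_closure_subset fun t ht => ?_
    have hf : ∃ᶠ s in 𝓝 t, γ =ᶠ[𝓝 s] σ := mem_closure_iff_frequently.1 ht
    have h0 : γ t = σ t := by
      have hcl : IsClosed {s | γ s = σ s} := isClosed_eq hγ.1.continuous hσ.1.continuous
      exact hcl.closure_subset (mem_closure_iff_frequently.2 (hf.mono fun s hs => hs.self_of_nhds))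
    have hs : γ t ∈ (extChartAt (𝓡 n) (γ t)).source := mem_extChartAt_source _
    refine hγ.eventuallyEq hσ (γ t) hs h0 ?_
    have c1 := (hγ.contDiffAt_extChartAt (γ t) hs).continuousAt_deriv_of_infty
    have hs' : σ t ∈ (extChartAt (𝓡 n) (γ t)).source := by rw [← h0]; exact hs
    have c2 := (hσ.contDiffAt_extChartAt (γ t) hs').continuousAt_deriv_of_infty
    by_contra hne
    obtain ⟨s, hs1, hs2⟩ := (hf.and_eventually (c1.prodMk c2 |>.eventually
      (isOpen_ne_fun continuous_fst continuous_snd |>.mem_nhds hne))).exists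
    refine hs2 (Filter.EventuallyEq.deriv_eq ?_)
    filter_upwards [hs1] with r hr
    rw [hr]
  have huniv := IsClopen.eq_univ ⟨hclosed, hopen⟩ ⟨t₀, h⟩
  funext t
  exact (huniv.symm ▸ mem_univ t : t ∈ {t | γ =ᶠ[𝓝 t] σ}).self_of_nhds

theorem IsGeodesicFrom.unique {x : M} {v : TangentSpace (𝓡 n) x} {γ σ : ℝ → M}
    (hγ : IsGeodesicFrom v γ) (hσ : IsGeodesicFrom v σ) : γ = σ := by
  have h : (⟨γ 0, mfderiv 𝓘(ℝ, ℝ) (𝓡 n) γ 0 (1 : ℝ)⟩ : TangentBundle (𝓡 n) M)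
    = ⟨σ 0, mfderiv 𝓘(ℝ, ℝ) (𝓡 n) σ 0 (1 : ℝ)⟩ := hγ.2.trans hσ.2.symm
  have h0 : γ 0 = σ 0 := congrArg TotalSpace.proj h
  have hs : γ 0 ∈ (extChartAt (𝓡 n) (γ 0)).source := mem_extChartAt_source _
  have hs' : σ 0 ∈ (extChartAt (𝓡 n) (γ 0)).source := by rw [← h0]; exact hs
  refine hγ.1.eq_of_eventuallyEq hσ.1 (hγ.1.eventuallyEq hσ.1 (γ 0) hs h0 ?_)
  rw [deriv_extChartAt_comp (γ 0) (hγ.1.1.mdifferentiableAt (by simp)) hs,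
    deriv_extChartAt_comp (γ 0) (hσ.1.1.mdifferentiableAt (by simp)) hs', h]

theorem IsGeodesicFrom.expMap_eq {x : M} {v : TangentSpace (𝓡 n) x} {γ : ℝ → M}
    (hγ : IsGeodesicFrom v γ) : expMap x v = γ 1 := by
  have h : ∃ γ : ℝ → M, IsGeodesicFrom v γ := ⟨γ, hγ⟩
  rw [expMap, dif_pos h, h.choose_spec.unique hγ]

end Geodesic

section Exponential

variable {n : ℕ} {M : Type*} [MetricSpace M] [ChartedSpace (EuclideanSpace ℝ (Fin n)) M]

theorem mfderiv_comp_mul_left {γ : ℝ → M} {a t : ℝ}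
    (hγ : MDifferentiableAt 𝓘(ℝ, ℝ) (𝓡 n) γ (a * t)) :
    mfderiv 𝓘(ℝ, ℝ) (𝓡 n) (fun s => γ (a * s)) t (1 : ℝ)
      = a • (mfderiv 𝓘(ℝ, ℝ) (𝓡 n) γ (a * t) (1 : ℝ) : TangentSpace (𝓡 n) (γ (a * t))) := by
  have h1 : HasMFDerivAt 𝓘(ℝ, ℝ) 𝓘(ℝ, ℝ) (fun s => a * s) t
      (ContinuousLinearMap.toSpanSingleton ℝ a) := by
    have : HasFDerivAt (fun s : ℝ => a * s) (ContinuousLinearMap.toSpanSingleton ℝ a) t := by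
      simpa using ((hasDerivAt_id t).const_mul a).hasFDerivAt
    exact this.hasMFDerivAt
  have h2 := (hγ.hasMFDerivAt.comp t h1).mfderiv
  have h3 : mfderiv 𝓘(ℝ, ℝ) (𝓡 n) (fun s => γ (a * s)) t (1 : ℝ)
    = mfderiv 𝓘(ℝ, ℝ) (𝓡 n) γ (a * t) ((ContinuousLinearMap.toSpanSingleton ℝ a) 1) :=
    DFunLike.congr_fun h2 (1 : ℝ)
  have h4 : (ContinuousLinearMap.toSpanSingleton ℝ a) 1 = a • (1 : ℝ) := by simp
  rw [h3, h4]
  exact map_smul (mfderiv 𝓘(ℝ, ℝ) (𝓡 n) γ (a * t)) a (1 : ℝ)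

variable [IsManifold (𝓡 n) ∞ M] [RiemannianBundle (fun x : M => TangentSpace (𝓡 n) x)]
  [IsContMDiffRiemannianBundle (𝓡 n) ∞ (EuclideanSpace ℝ (Fin n))
    (fun x : M => TangentSpace (𝓡 n) x)]

theorem IsGeodesic.comp_mul_left {γ : ℝ → M} (hγ : IsGeodesic n γ) (a : ℝ) :
    IsGeodesic n fun t => γ (a * t) := by
  refine ⟨hγ.1.comp (contMDiff_iff_contDiff.2 (contDiff_const.mul contDiff_id)),
    fun p t ht z => ?_⟩
  have h1 : ∀ s, deriv (fun s => extChartAt (𝓡 n) p (γ (a * s))) s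
      = a • deriv (fun s => extChartAt (𝓡 n) p (γ s)) (a * s) := fun s =>
    deriv_comp_mul_left a (fun s => extChartAt (𝓡 n) p (γ s)) s
  have h2 : deriv (deriv fun s => extChartAt (𝓡 n) p (γ (a * s))) t
      = a • a • deriv (deriv fun s => extChartAt (𝓡 n) p (γ s)) (a * t) := by
    rw [funext h1, deriv_fun_const_smul_field, deriv_comp_mul_left]
  have h := hγ.chartGram_equation p ht z
  rw [chartChristoffel_self p ((extChartAt (𝓡 n) p).map_source ht), h1, h2, ← chartGram_apply]
  rw [christoffelForm_apply] at h
  simp only [map_smul, smul_apply, smul_eq_mul]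
  simp only at h
  linear_combination a * a * h

theorem isGeodesic_const (x : M) : IsGeodesic n fun _ : ℝ => x := by
  refine ⟨contMDiff_const, fun p t ht z => ?_⟩
  rw [chartChristoffel_self p ((extChartAt (𝓡 n) p).map_source ht), ← chartGram_apply]
  simp

theorem isGeodesicFrom_const (x : M) :
    IsGeodesicFrom (0 : TangentSpace (𝓡 n) x) fun _ : ℝ => x := by
  refine ⟨isGeodesic_const x, ?_⟩
  rw [mfderiv_const]
  rfl

theorem expMap_zero (x : M) : expMap x (0 : TangentSpace (𝓡 n) x) = x :=
  (isGeodesicFrom_const x).expMap_eq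

theorem IsGeodesicFrom.comp_mul_left {x : M} {v : TangentSpace (𝓡 n) x} {γ : ℝ → M}
    (hγ : IsGeodesicFrom v γ) (a : ℝ) : IsGeodesicFrom (a • v) fun t => γ (a * t) := by
  refine ⟨hγ.1.comp_mul_left a, ?_⟩
  rw [mfderiv_comp_mul_left (hγ.1.1.mdifferentiableAt (by simp))]
  let G : ℝ → TangentBundle (𝓡 n) M := fun s =>
    ⟨γ s, a • (mfderiv 𝓘(ℝ, ℝ) (𝓡 n) γ s (1 : ℝ) : TangentSpace (𝓡 n) (γ s))⟩
  have h0 : G (a * 0) = G 0 := by rw [mul_zero]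
  refine h0.trans ?_
  exact congrArg (fun z : TangentBundle (𝓡 n) M => (⟨z.1, a • z.2⟩ : TangentBundle (𝓡 n) M)) hγ.2

theorem IsGeodesicFrom.expMap_smul {x : M} {v : TangentSpace (𝓡 n) x} {γ : ℝ → M}
    (hγ : IsGeodesicFrom v γ) (a : ℝ) : expMap x (a • v) = γ a := by
  rw [(hγ.comp_mul_left a).expMap_eq, mul_one]

theorem ExpDiffeoOnBall.exists_isGeodesicFrom {x : M} {r : ℝ} (h : ExpDiffeoOnBall n x r)
    (hr : 0 < r) (v : TangentSpace (𝓡 n) x) : ∃ γ : ℝ → M, IsGeodesicFrom v γ := by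
  rcases eq_or_ne v 0 with rfl | hv
  · exact ⟨_, isGeodesicFrom_const x⟩
  obtain ⟨a, ha, hav⟩ : ∃ a : ℝ, 0 < a ∧ ‖a • v‖ < r := by
    have hv' : 0 < ‖v‖ := norm_pos_iff.2 hv
    refine ⟨r / (2 * ‖v‖), by positivity, ?_⟩
    rw [norm_smul, Real.norm_of_nonneg (by positivity)]
    field_simp
    linarith
  have hex : ∃ γ : ℝ → M, IsGeodesicFrom (a • v) γ := by
    by_contra hne
    have h1 : expMap x (a • v) = x := by rw [expMap, dif_neg hne]
    have h2 : a • v = 0 := h.1.injOn (by simpa using hav) (by simpa using hr)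
      (h1.trans (expMap_zero x).symm)
    exact hv ((smul_eq_zero.1 h2).resolve_left ha.ne')
  obtain ⟨γ, hγ⟩ := hex
  have := hγ.comp_mul_left a⁻¹
  rw [smul_smul, inv_mul_cancel₀ ha.ne', one_smul] at this
  exact ⟨_, this⟩

end Exponential

section FirstVariation

variable {E : Type*} [NormedAddCommGroup E] [NormedSpace ℝ E]

theorem DifferentiableAt.hasDerivAt_comp_curve {F : Type*} [NormedAddCommGroup F] [NormedSpace ℝ F]
    {G : E → F} {c : ℝ → E} {c' : E} {t : ℝ} (hG : DifferentiableAt ℝ G (c t))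
    (hc : HasDerivAt c c' t) : HasDerivAt (fun s => G (c s)) (fderiv ℝ G (c t) c') t :=
  hG.hasFDerivAt.comp_hasDerivAt t hc

theorem hasDerivAt_bilinear_along {G : E → E →L[ℝ] E →L[ℝ] ℝ} {c X Y : ℝ → E} {c' X' Y' : E} {t : ℝ}
    (hG : DifferentiableAt ℝ G (c t)) (hc : HasDerivAt c c' t) (hX : HasDerivAt X X' t)
    (hY : HasDerivAt Y Y' t) :
    HasDerivAt (fun s => G (c s) (X s) (Y s))
      (fderiv ℝ G (c t) c' (X t) (Y t) + G (c t) X' (Y t) + G (c t) (X t) Y') t := by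
  have h1 := DifferentiableAt.hasDerivAt_comp_curve (F := E →L[ℝ] E →L[ℝ] ℝ) hG hc
  have h2 := (h1.clm_apply hX).clm_apply hY
  simpa using h2

theorem hasDerivAt_speed_eq_zero {G : E → E →L[ℝ] E →L[ℝ] ℝ} {c : ℝ → E} {t : ℝ}
    (hG : DifferentiableAt ℝ G (c t)) (hsymm : ∀ u v w, G u v w = G u w v)
    (hc : DifferentiableAt ℝ c t) (hc' : DifferentiableAt ℝ (deriv c) t)
    (h : ∀ z, G (c t) (deriv (deriv c) t) z + christoffelForm G (c t, deriv c t) z = 0) :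
    HasDerivAt (fun s => G (c s) (deriv c s) (deriv c s)) 0 t := by
  refine (hasDerivAt_bilinear_along hG hc.hasDerivAt hc'.hasDerivAt hc'.hasDerivAt).congr_deriv ?_
  have := h (deriv c t)
  rw [christoffelForm_apply] at this
  rw [hsymm _ (deriv c t) (deriv (deriv c) t)]
  simp only at this
  linarith

theorem hasDerivAt_first_variation {G : E → E →L[ℝ] E →L[ℝ] ℝ} {C : ℝ × ℝ → E} {s t e' : ℝ}
    (hG : DifferentiableAt ℝ G (C (s, t))) (hsymm : ∀ u v w, G u v w = G u w v)
    (hC : ContDiffAt ℝ ∞ C (s, t))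
    (h : ∀ z, G (C (s, t)) (deriv (deriv fun τ => C (s, τ)) t) z
      + christoffelForm G (C (s, t), deriv (fun τ => C (s, τ)) t) z = 0)
    (he : HasDerivAt (fun σ => G (C (σ, t)) (fderiv ℝ C (σ, t) (0, 1)) (fderiv ℝ C (σ, t) (0, 1)))
      e' s) :
    HasDerivAt (fun τ => G (C (s, τ)) (fderiv ℝ C (s, τ) (0, 1)) (fderiv ℝ C (s, τ) (1, 0)))
      (e' / 2) t := by
  have hev : ∀ᶠ q in 𝓝 (s, t), ContDiffAt ℝ 1 C q :=
    (hC.of_le (m := 1) (by norm_cast)).eventually (by simp)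
  have hC1 : ∀ q, ContDiffAt ℝ 1 C q → HasFDerivAt C (fderiv ℝ C q) q := fun q hq =>
    (hq.differentiableAt (by simp)).hasFDerivAt
  have hC2 : HasFDerivAt (fderiv ℝ C) (fderiv ℝ (fderiv ℝ C) (s, t)) (s, t) :=
    ((hC.fderiv_right (m := 1) (by norm_cast)).differentiableAt (by simp)).hasFDerivAt
  have hsm : fderiv ℝ (fderiv ℝ C) (s, t) (0, 1) (1, 0) = fderiv ℝ (fderiv ℝ C) (s, t) (1, 0) (0, 1) :=
    (hC.isSymmSndFDerivAt (by simpa using by norm_cast)) (0, 1) (1, 0)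
  have pt : ∀ τ, HasDerivAt (fun τ : ℝ => (s, τ)) ((0, 1) : ℝ × ℝ) τ := fun τ =>
    (hasDerivAt_const τ s).prodMk (hasDerivAt_id τ)
  have ps : ∀ σ, HasDerivAt (fun σ : ℝ => (σ, t)) ((1, 0) : ℝ × ℝ) σ := fun σ =>
    (hasDerivAt_id σ).prodMk (hasDerivAt_const σ t)
  have dC : ∀ (d : ℝ × ℝ) (γ : ℝ → ℝ × ℝ) (γ' : ℝ × ℝ) (r : ℝ), γ r = (s, t) → HasDerivAt γ γ' r →
      HasDerivAt (fun ρ => fderiv ℝ C (γ ρ) d) (fderiv ℝ (fderiv ℝ C) (s, t) γ' d) r := by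
    intro d γ γ' r hr hγ
    rw [← hr] at hC2 ⊢
    simpa using (hC2.comp_hasDerivAt r hγ).clm_apply (hasDerivAt_const r d)
  have hct : HasDerivAt (fun τ => C (s, τ)) (fderiv ℝ C (s, t) (0, 1)) t :=
    HasFDerivAt.comp_hasDerivAt (f := fun τ => (s, τ)) t (hC1 _ hev.self_of_nhds) (pt t)
  have hcs : HasDerivAt (fun σ => C (σ, t)) (fderiv ℝ C (s, t) (1, 0)) s :=
    HasFDerivAt.comp_hasDerivAt (f := fun σ => (σ, t)) s (hC1 _ hev.self_of_nhds) (ps s)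
  have hd : deriv (fun τ => C (s, τ)) =ᶠ[𝓝 t] fun τ => fderiv ℝ C (s, τ) (0, 1) := by
    have := (pt t).continuousAt.eventually hev
    filter_upwards [this] with τ hτ
    exact (HasFDerivAt.comp_hasDerivAt (f := fun τ => (s, τ)) τ (hC1 _ hτ) (pt τ)).deriv
  have hdd : deriv (deriv fun τ => C (s, τ)) t = fderiv ℝ (fderiv ℝ C) (s, t) (0, 1) (0, 1) := by
    rw [hd.deriv_eq]
    exact (dC (0, 1) _ _ t rfl (pt t)).deriv
  have he2 := (hasDerivAt_bilinear_along (G := G) (c := fun σ => C (σ, t)) hG hcs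
    (dC (0, 1) _ _ s rfl (ps s)) (dC (0, 1) _ _ s rfl (ps s))).unique he
  refine (hasDerivAt_bilinear_along (G := G) (c := fun τ => C (s, τ)) hG hct
    (dC (0, 1) _ _ t rfl (pt t)) (dC (1, 0) _ _ t rfl (pt t))).congr_deriv ?_
  have hz := h (fderiv ℝ C (s, t) (1, 0))
  rw [christoffelForm_apply, hdd, hd.self_of_nhds] at hz
  rw [hsymm _ (fderiv ℝ (fderiv ℝ C) (s, t) (1, 0) (0, 1))] at he2
  rw [hsm]
  simp only at hz he2
  linarith

end FirstVariation

section Gauss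

variable {n : ℕ} {M : Type*} [MetricSpace M] [ChartedSpace (EuclideanSpace ℝ (Fin n)) M]
  [RiemannianBundle (fun x : M => TangentSpace (𝓡 n) x)]

theorem ExpDiffeoOnBall.contMDiffAt {x : M} {R : ℝ} (hE : ExpDiffeoOnBall n x R)
    {z : TangentSpace (𝓡 n) x} (hz : ‖z‖ < R) :
    ContMDiffAt 𝓘(ℝ, TangentSpace (𝓡 n) x) (𝓡 n) ∞ (expMap x) z :=
  hE.2.1.contMDiffAt (Metric.isOpen_ball.mem_nhds (by simpa using hz))

variable [IsManifold (𝓡 n) ∞ M]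

theorem inner_mfderiv_eq_chartGram (p : M) {γ : ℝ → M} {t : ℝ}
    (hγ : MDifferentiableAt 𝓘(ℝ, ℝ) (𝓡 n) γ t) (ht : γ t ∈ (extChartAt (𝓡 n) p).source) :
    inner ℝ (mfderiv 𝓘(ℝ, ℝ) (𝓡 n) γ t (1 : ℝ) : TangentSpace (𝓡 n) (γ t))
        (mfderiv 𝓘(ℝ, ℝ) (𝓡 n) γ t (1 : ℝ))
      = chartGram p (extChartAt (𝓡 n) p (γ t)) (deriv (fun s => extChartAt (𝓡 n) p (γ s)) t)
        (deriv (fun s => extChartAt (𝓡 n) p (γ s)) t) := by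
  rw [inner_eq_chartMetric p ht, deriv_extChartAt_comp p hγ ht]
  rfl

/-- The derivative of the exponential map. -/
noncomputable def expDeriv (x : M) (z : TangentSpace (𝓡 n) x) :
    TangentSpace (𝓡 n) x →L[ℝ] TangentSpace (𝓡 n) (expMap x z) :=
  mfderiv 𝓘(ℝ, TangentSpace (𝓡 n) x) (𝓡 n) (expMap x) z

theorem inner_expDeriv_eq_chartGram (p x : M) {z : TangentSpace (𝓡 n) x}
    (hz : MDifferentiableAt 𝓘(ℝ, TangentSpace (𝓡 n) x) (𝓡 n) (expMap x) z)
    (hp : expMap x z ∈ (extChartAt (𝓡 n) p).source) (a b : TangentSpace (𝓡 n) x) :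
    inner ℝ (expDeriv x z a) (expDeriv x z b)
      = chartGram p (extChartAt (𝓡 n) p (expMap x z))
        (fderiv ℝ (fun y => extChartAt (𝓡 n) p (expMap x y)) z a)
        (fderiv ℝ (fun y => extChartAt (𝓡 n) p (expMap x y)) z b) := by
  rw [inner_eq_chartMetric p hp, fderiv_extChartAt_comp p hz hp, fderiv_extChartAt_comp p hz hp]
  rfl

variable [IsContMDiffRiemannianBundle (𝓡 n) ∞ (EuclideanSpace ℝ (Fin n))
    (fun x : M => TangentSpace (𝓡 n) x)]

theorem IsGeodesic.hasDerivAt_speed {γ : ℝ → M} (hγ : IsGeodesic n γ) (t : ℝ) :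
    HasDerivAt (fun s => inner ℝ (mfderiv 𝓘(ℝ, ℝ) (𝓡 n) γ s (1 : ℝ) : TangentSpace (𝓡 n) (γ s))
        (mfderiv 𝓘(ℝ, ℝ) (𝓡 n) γ s (1 : ℝ))) 0 t := by
  have hs : γ t ∈ (extChartAt (𝓡 n) (γ t)).source := mem_extChartAt_source _
  have hc := hγ.contDiffAt_extChartAt (γ t) hs
  have h := hasDerivAt_speed_eq_zero (G := chartGram (γ t))
    (c := fun s => extChartAt (𝓡 n) (γ t) (γ s)) (t := t)
    ((contDiffAt_chartGram (γ t) ((extChartAt (𝓡 n) (γ t)).map_source hs)).differentiableAt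
      (by simp))
    (fun u v w => chartMetric_symm _ u v w) (hc.differentiableAt (by simp))
    (((hc.fderiv_right (m := 1) (by norm_cast)).clm_apply
        (contDiffAt_const (c := (1 : ℝ)))).differentiableAt (by simp))
    (hγ.chartGram_equation (γ t) hs)
  refine h.congr_of_eventuallyEq ?_
  filter_upwards [hγ.eventually_mem_source (γ t) hs] with s hs'
  exact inner_mfderiv_eq_chartGram (γ t) (hγ.1.mdifferentiableAt (by simp)) hs'

theorem IsGeodesicFrom.speed_eq {x : M} {v : TangentSpace (𝓡 n) x} {γ : ℝ → M}
    (hγ : IsGeodesicFrom v γ) (t : ℝ) :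
    inner ℝ (mfderiv 𝓘(ℝ, ℝ) (𝓡 n) γ t (1 : ℝ) : TangentSpace (𝓡 n) (γ t))
        (mfderiv 𝓘(ℝ, ℝ) (𝓡 n) γ t (1 : ℝ)) = inner ℝ v v := by
  have h := is_const_of_deriv_eq_zero (fun t => (hγ.1.hasDerivAt_speed t).differentiableAt)
    (fun t => (hγ.1.hasDerivAt_speed t).deriv) t 0
  refine h.trans ?_
  exact congrArg (fun z : TangentBundle (𝓡 n) M => (inner ℝ z.2 z.2 : ℝ)) hγ.2

theorem ExpDiffeoOnBall.hasDerivAt_inner_expDeriv {x : M} {R : ℝ} (hE : ExpDiffeoOnBall n x R)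
    (hR : 0 < R) (v w : TangentSpace (𝓡 n) x) {t : ℝ} (ht : ‖t • v‖ < R) :
    HasDerivAt (fun τ : ℝ => inner ℝ (expDeriv x (τ • v) v) (expDeriv x (τ • v) (τ • w)))
      (inner ℝ v w) t := by
  set p := expMap x (t • v) with hp
  have hs : expMap x (t • v) ∈ (extChartAt (𝓡 n) p).source := mem_extChartAt_source _
  set ψ : TangentSpace (𝓡 n) x → EuclideanSpace ℝ (Fin n) :=
    fun y => extChartAt (𝓡 n) p (expMap x y) with hψ
  have hsrc : ∀ᶠ y in 𝓝 (t • v), expMap x y ∈ (extChartAt (𝓡 n) p).source :=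
    (hE.contMDiffAt ht).continuousAt.preimage_mem_nhds ((isOpen_extChartAt_source p).mem_nhds hs)
  have hnorm : ∀ᶠ y in 𝓝 (t • v), ‖y‖ < R :=
    continuous_norm.continuousAt.eventually_lt continuousAt_const ht
  have hψd : ContDiffAt ℝ ∞ ψ (t • v) := by
    rw [← contMDiffAt_iff_contDiffAt]
    exact (contMDiffAt_extChartAt' (by simpa using hs)).comp _ (hE.contMDiffAt ht)
  set ℓ : ℝ × ℝ → TangentSpace (𝓡 n) x := fun q => q.2 • (v + q.1 • w) with hℓ
  have hℓd : ContDiff ℝ ∞ ℓ := contDiff_snd.smul (contDiff_const.add (contDiff_fst.smul contDiff_const))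
  have hℓ0 : ∀ τ, ℓ (0, τ) = τ • v := fun τ => by simp [hℓ]
  set C : ℝ × ℝ → EuclideanSpace ℝ (Fin n) := fun q => ψ (ℓ q) with hCdef
  have hC : ContDiffAt ℝ ∞ C (0, t) := by
    refine ContDiffAt.comp (g := ψ) (f := ℓ) (0, t) ?_ hℓd.contDiffAt
    rw [hℓ0]
    exact hψd
  have dℓt : ∀ s τ, fderiv ℝ ℓ (s, τ) (0, 1) = v + s • w := by
    intro s τ
    have h1 := DifferentiableAt.hasDerivAt_comp_curve (G := ℓ) (c := fun τ => (s, τ)) (t := τ)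
      (hℓd.differentiable (by simp) _) ((hasDerivAt_const τ s).prodMk (hasDerivAt_id τ))
    have h2 : HasDerivAt (fun τ => ℓ (s, τ)) ((1 : ℝ) • (v + s • w)) τ :=
      (hasDerivAt_id τ).smul_const (v + s • w)
    rw [h1.unique h2, one_smul]
  have dℓs : ∀ s τ, fderiv ℝ ℓ (s, τ) (1, 0) = τ • w := by
    intro s τ
    have h1 := DifferentiableAt.hasDerivAt_comp_curve (G := ℓ) (c := fun σ => (σ, τ)) (t := s)
      (hℓd.differentiable (by simp) _) ((hasDerivAt_id s).prodMk (hasDerivAt_const s τ))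
    have h2 : HasDerivAt (fun σ => ℓ (σ, τ)) (τ • ((1 : ℝ) • w)) s :=
      (((hasDerivAt_id s).smul_const w).const_add v).const_smul τ
    rw [h1.unique h2, one_smul]
  have hℓc : Tendsto ℓ (𝓝 ((0 : ℝ), t)) (𝓝 (t • v)) := by
    rw [← hℓ0 t]
    exact hℓd.continuous.continuousAt
  have hψe : ∀ᶠ q in 𝓝 ((0 : ℝ), t), DifferentiableAt ℝ ψ (ℓ q) :=
    hℓc.eventually (((hψd.of_le (m := 1) (by norm_cast)).eventually (by simp)).mono
      fun y hy => hy.differentiableAt (by simp))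
  have dC : ∀ᶠ q in 𝓝 ((0 : ℝ), t), DifferentiableAt ℝ C q ∧
      ∀ d, fderiv ℝ C q d = fderiv ℝ ψ (ℓ q) (fderiv ℝ ℓ q d) := by
    filter_upwards [hψe] with q hq
    have h1 : HasFDerivAt C ((fderiv ℝ ψ (ℓ q)).comp (fderiv ℝ ℓ q)) q :=
      hq.hasFDerivAt.comp q (hℓd.differentiable (by simp) q).hasFDerivAt
    exact ⟨h1.differentiableAt, fun d => by rw [h1.fderiv]; rfl⟩
  have hgeo : ∀ s : ℝ, ∃ γ : ℝ → M, IsGeodesicFrom (v + s • w) γ :=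
    fun s => hE.exists_isGeodesicFrom hR (v + s • w)
  choose γ hγ using hgeo
  have hCγ : ∀ s, (fun τ => C (s, τ)) = fun τ => extChartAt (𝓡 n) p (γ s τ) := by
    intro s
    funext τ
    simp only [hCdef, hψ, hℓ, (hγ s).expMap_smul τ]
  have hγs : ∀ᶠ q in 𝓝 ((0 : ℝ), t), γ q.1 q.2 ∈ (extChartAt (𝓡 n) p).source := by
    filter_upwards [hℓc.eventually hsrc] with q hq
    rwa [← (hγ q.1).expMap_smul q.2]
  have he : HasDerivAt (fun σ => chartGram p (C (σ, t)) (fderiv ℝ C (σ, t) (0, 1))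
      (fderiv ℝ C (σ, t) (0, 1))) (2 * inner ℝ v w) 0 := by
    have h1 : HasDerivAt (fun σ : ℝ => v + σ • w) ((1 : ℝ) • w) 0 :=
      ((hasDerivAt_id (0 : ℝ)).smul_const w).const_add v
    have h2 := h1.inner ℝ h1
    have hc0 : Tendsto (fun σ : ℝ => (σ, t)) (𝓝 0) (𝓝 (0, t)) :=
      (Continuous.prodMk_left t).continuousAt
    refine (h2.congr_of_eventuallyEq ?_).congr_deriv ?_
    · filter_upwards [hc0.eventually dC, hc0.eventually hγs] with σ h3 h4
      have h5 := DifferentiableAt.hasDerivAt_comp_curve (G := C) (c := fun τ => (σ, τ)) (t := t)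
        h3.1 ((hasDerivAt_const t σ).prodMk (hasDerivAt_id t))
      rw [← h5.deriv, hCγ, congrFun (hCγ σ) t]
      rw [← inner_mfderiv_eq_chartGram p ((hγ σ).1.1.mdifferentiableAt (by simp)) h4]
      exact (hγ σ).speed_eq t
    · simp [real_inner_comm]
      ring
  have hgeq : ∀ z, chartGram p (C (0, t)) (deriv (deriv fun τ => C (0, τ)) t) z
      + christoffelForm (chartGram p) (C (0, t), deriv (fun τ => C (0, τ)) t) z = 0 := by
    rw [hCγ, congrFun (hCγ 0) t]
    exact (hγ 0).1.chartGram_equation p hγs.self_of_nhds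
  have h := hasDerivAt_first_variation (G := chartGram p) (C := C) (s := 0) (t := t)
    ((contDiffAt_chartGram p (by
      simp only [hCdef, hℓ0]
      exact (extChartAt (𝓡 n) p).map_source hs)).differentiableAt (by simp))
    (fun u v w => chartMetric_symm _ u v w) hC hgeq he
  rw [mul_div_cancel_left₀ _ (two_ne_zero)] at h
  refine h.congr_of_eventuallyEq ?_
  have hc0 : Tendsto (fun τ : ℝ => ((0 : ℝ), τ)) (𝓝 t) (𝓝 (0, t)) :=
    (Continuous.prodMk_right (0 : ℝ)).continuousAt
  filter_upwards [hc0.eventually dC, hc0.eventually (hℓc.eventually hsrc),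
    hc0.eventually (hℓc.eventually hnorm)] with τ h1 h2 h3
  rw [hℓ0] at h2 h3
  rw [inner_expDeriv_eq_chartGram p x ((hE.contMDiffAt h3).mdifferentiableAt (by simp)) h2,
    h1.2, h1.2, dℓt, dℓs, zero_smul, add_zero, hℓ0]
  simp only [hCdef, hψ, hℓ0]

/-- **Gauss lemma**. -/
theorem ExpDiffeoOnBall.inner_expDeriv_radial {x : M} {R : ℝ} (hE : ExpDiffeoOnBall n x R)
    {v : TangentSpace (𝓡 n) x} (hv : ‖v‖ < R) (w : TangentSpace (𝓡 n) x) :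
    inner ℝ (expDeriv x v v) (expDeriv x v w) = inner ℝ v w := by
  have hR : 0 < R := (norm_nonneg v).trans_lt hv
  have hd : ∀ t ∈ Icc (0 : ℝ) 1,
      HasDerivAt (fun τ : ℝ => inner ℝ (expDeriv x (τ • v) v) (expDeriv x (τ • v) (τ • w))
        - τ * inner ℝ v w) 0 t := by
    intro t ht
    have h1 : ‖t • v‖ < R := by
      rw [norm_smul, Real.norm_of_nonneg ht.1]
      exact (mul_le_of_le_one_left (norm_nonneg v) ht.2).trans_lt hv
    exact ((hE.hasDerivAt_inner_expDeriv hR v w h1).sub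
      ((hasDerivAt_id t).mul_const (inner ℝ v w))).congr_deriv (by simp)
  have h := constant_of_has_deriv_right_zero
    (fun t ht => (hd t ht).continuousAt.continuousWithinAt)
    (fun t ht => (hd t (Ico_subset_Icc_self ht)).hasDerivWithinAt) 1 (right_mem_Icc.2 zero_le_one)
  simp only [one_smul, zero_smul, map_zero, inner_zero_right] at h
  have h1 : ∀ z : TangentSpace (𝓡 n) x, z = v →
      inner ℝ (expDeriv x z v) (expDeriv x z w) = inner ℝ (expDeriv x v v) (expDeriv x v w) := by
    rintro z rfl
    rfl
  rw [h1 _ (one_smul ℝ v)] at h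
  linarith

end Gauss

section Distance

variable {n : ℕ} {M : Type*} [MetricSpace M] [ChartedSpace (EuclideanSpace ℝ (Fin n)) M]

theorem MDifferentiableAt.hasDerivWithinAt_comp_curve {N : M → ℝ} {σ : ℝ → M} {s : Set ℝ} {t : ℝ}
    {L : ℝ →L[ℝ] TangentSpace (𝓡 n) (σ t)} (hN : MDifferentiableAt (𝓡 n) 𝓘(ℝ, ℝ) N (σ t))
    (hσ : HasMFDerivWithinAt 𝓘(ℝ, ℝ) (𝓡 n) σ s t L) :
    HasDerivWithinAt (fun τ => N (σ τ)) (mvfderiv (𝓡 n) N (σ t) (L 1)) s t := by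
  have h : HasFDerivWithinAt (fun τ => N (σ τ)) (mvfderiv (𝓡 n) N (σ t) ∘L L) s t :=
    (hN.hasMFDerivAt.comp_hasMFDerivWithinAt t hσ).hasFDerivWithinAt
  exact h.hasDerivWithinAt

variable [RiemannianBundle (fun x : M => TangentSpace (𝓡 n) x)]

theorem edist_le_pathELength [IsRiemannianManifold (𝓡 n) M] {σ : ℝ → M} {t : ℝ}
    (hσ : ContMDiffOn 𝓘(ℝ, ℝ) (𝓡 n) 1 σ (Icc 0 1)) (ht : t ∈ Icc (0 : ℝ) 1) :
    edist (σ 0) (σ t) ≤ pathELength (𝓡 n) σ 0 1 := by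
  rw [IsRiemannianManifold.out (I := 𝓡 n) (σ 0) (σ t)]
  exact (riemannianEDist_le_pathELength (hσ.mono (Icc_subset_Icc_right ht.2)) rfl rfl ht.1).trans
    (pathELength_mono le_rfl ht.2)

theorem expDeriv_surjective {x : M} {v : TangentSpace (𝓡 n) x} {g : M → TangentSpace (𝓡 n) x}
    (hexp : MDifferentiableAt 𝓘(ℝ, TangentSpace (𝓡 n) x) (𝓡 n) (expMap x) v)
    (hg : MDifferentiableAt (𝓡 n) 𝓘(ℝ, TangentSpace (𝓡 n) x) g (expMap x v))
    (h : ∀ᶠ z in 𝓝 v, g (expMap x z) = z) : Function.Surjective (expDeriv x v) := by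
  have : FiniteDimensional ℝ (TangentSpace (𝓡 n) x) :=
    inferInstanceAs (FiniteDimensional ℝ (EuclideanSpace ℝ (Fin n)))
  have : FiniteDimensional ℝ (TangentSpace (𝓡 n) (expMap x v)) :=
    inferInstanceAs (FiniteDimensional ℝ (EuclideanSpace ℝ (Fin n)))
  have hinj : Function.Injective (expDeriv x v) := by
    have h1 : HasFDerivAt (fun z => g (expMap x z)) (mvfderiv (𝓡 n) g (expMap x v) ∘L expDeriv x v) v :=
      (hg.hasMFDerivAt.comp v hexp.hasMFDerivAt).hasFDerivAt
    have h2 : HasFDerivAt (fun z => g (expMap x z)) (ContinuousLinearMap.id ℝ _) v :=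
      (hasFDerivAt_id v).congr_of_eventuallyEq h
    intro a b hab
    have h3 := DFunLike.congr_fun (h1.unique h2)
    rw [← ContinuousLinearMap.id_apply (R₁ := ℝ) a, ← ContinuousLinearMap.id_apply (R₁ := ℝ) b,
      ← h3, ← h3]
    simp [hab]
  have := (LinearMap.injective_iff_surjective_of_finrank_eq_finrank
    (f := (expDeriv x v : TangentSpace (𝓡 n) x →ₗ[ℝ] TangentSpace (𝓡 n) (expMap x v))) rfl).1 hinj
  exact this

variable [IsManifold (𝓡 n) ∞ M] [IsContMDiffRiemannianBundle (𝓡 n) ∞ (EuclideanSpace ℝ (Fin n))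
    (fun x : M => TangentSpace (𝓡 n) x)]

theorem ExpDiffeoOnBall.abs_mvfderiv_norm_sq_le {x : M} {R : ℝ} (hE : ExpDiffeoOnBall n x R)
    {g : M → TangentSpace (𝓡 n) x} (hg : LeftInvOn g (expMap x) (Metric.ball 0 R))
    (hgs : ContMDiffOn (𝓡 n) 𝓘(ℝ, TangentSpace (𝓡 n) x) ∞ g (Metric.ball x R))
    {y : M} (hy : y ∈ Metric.ball x R) (X : TangentSpace (𝓡 n) y) :
    |mvfderiv (𝓡 n) (fun z => ‖g z‖ ^ 2) y X| ≤ 2 * ‖g y‖ * ‖X‖ := by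
  obtain ⟨v, hv, rfl⟩ := hE.1.surjOn hy
  have hv' : ‖v‖ < R := by simpa using hv
  have hexp := (hE.contMDiffAt hv').mdifferentiableAt (by simp)
  have hgd := (hgs.contMDiffAt (Metric.isOpen_ball.mem_nhds hy)).mdifferentiableAt (by simp)
  have hev : ∀ᶠ z in 𝓝 v, g (expMap x z) = z := by
    filter_upwards [Metric.isOpen_ball.mem_nhds hv] with z hz using hg hz
  obtain ⟨ξ, rfl⟩ := expDeriv_surjective hexp hgd hev X
  have hN : MDifferentiableAt (𝓡 n) 𝓘(ℝ, ℝ) (fun z => ‖g z‖ ^ 2) (expMap x v) := by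
    have : DifferentiableAt ℝ (fun w : TangentSpace (𝓡 n) x => ‖w‖ ^ 2) (g (expMap x v)) :=
      (contDiff_norm_sq ℝ).differentiable (n := 1) (by simp) _
    exact this.mdifferentiableAt.comp _ hgd
  have h1 : HasFDerivAt (fun z => ‖g (expMap x z)‖ ^ 2)
      (mvfderiv (𝓡 n) (fun z => ‖g z‖ ^ 2) (expMap x v) ∘L expDeriv x v) v :=
    (hN.hasMFDerivAt.comp v hexp.hasMFDerivAt).hasFDerivAt
  have h2 : HasFDerivAt (fun z => ‖g (expMap x z)‖ ^ 2) (2 • innerSL ℝ v) v := by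
    refine (hasStrictFDerivAt_norm_sq v).hasFDerivAt.congr_of_eventuallyEq ?_
    filter_upwards [hev] with z hz
    rw [hz]
  have h3 : mvfderiv (𝓡 n) (fun z => ‖g z‖ ^ 2) (expMap x v) (expDeriv x v ξ) = 2 * inner ℝ v ξ := by
    have := DFunLike.congr_fun (h1.unique h2) ξ
    simpa using this
  have h4 : ‖expDeriv x v v‖ = ‖v‖ := by
    have := hE.inner_expDeriv_radial hv' v
    rw [real_inner_self_eq_norm_sq, real_inner_self_eq_norm_sq] at this
    exact (pow_left_inj₀ (norm_nonneg _) (norm_nonneg _) two_ne_zero).1 this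
  rw [h3, hg hv, ← hE.inner_expDeriv_radial hv' ξ, abs_mul, abs_two, mul_assoc]
  have h5 := abs_real_inner_le_norm (expDeriv x v v) (expDeriv x v ξ)
  rw [h4] at h5
  linarith

theorem ExpDiffeoOnBall.norm_le_of_path {x : M} {R : ℝ} (hE : ExpDiffeoOnBall n x R)
    {g : M → TangentSpace (𝓡 n) x} (hg : LeftInvOn g (expMap x) (Metric.ball 0 R))
    (hgs : ContMDiffOn (𝓡 n) 𝓘(ℝ, TangentSpace (𝓡 n) x) ∞ g (Metric.ball x R))
    {σ : ℝ → M} (hσ : ContMDiffOn 𝓘(ℝ, ℝ) (𝓡 n) 1 σ (Icc 0 1)) (h0 : σ 0 = x)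
    (hball : ∀ t ∈ Icc (0 : ℝ) 1, σ t ∈ Metric.ball x R) :
    ENNReal.ofReal ‖g (σ 1)‖ ≤ pathELength (𝓡 n) σ 0 1 := by
  have hR : 0 < R := Metric.pos_of_mem_ball (hball 0 (by simp))
  have hgx : g x = 0 := by
    have := hg (Metric.mem_ball_self hR)
    rwa [expMap_zero] at this
  refine ENNReal.le_of_forall_pos_le_add fun δ hδ _ => ?_
  have hδ' : (0 : ℝ) < δ := hδ
  have hN : ContMDiffOn (𝓡 n) 𝓘(ℝ, ℝ) 1 (fun z => ‖g z‖ ^ 2) (Metric.ball x R) := by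
    have h1 : ContMDiff 𝓘(ℝ, TangentSpace (𝓡 n) x) 𝓘(ℝ, ℝ) 1
      (fun w : TangentSpace (𝓡 n) x => ‖w‖ ^ 2) := (contDiff_norm_sq ℝ).contMDiff
    exact h1.comp_contMDiffOn (hgs.of_le (by norm_cast))
  have hNσ : ContDiffOn ℝ 1 (fun t => ‖g (σ t)‖ ^ 2) (Icc 0 1) :=
    contMDiffOn_iff_contDiffOn.1 (hN.comp hσ hball)
  have hpos : ∀ t, 0 < ‖g (σ t)‖ ^ 2 + (δ : ℝ) ^ 2 := fun t => by positivity
  have hf : ContDiffOn ℝ 1 (fun t => Real.sqrt (‖g (σ t)‖ ^ 2 + (δ : ℝ) ^ 2)) (Icc 0 1) :=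
    (hNσ.add contDiffOn_const).sqrt fun t _ => (hpos t).ne'
  have hle := enorm_sub_le_lintegral_derivWithin_Icc_of_contDiffOn_Icc hf zero_le_one
  have hder : ∀ t ∈ Icc (0 : ℝ) 1,
      ‖derivWithin (fun t => Real.sqrt (‖g (σ t)‖ ^ 2 + (δ : ℝ) ^ 2)) (Icc 0 1) t‖ₑ
        ≤ ‖(mfderivWithin 𝓘(ℝ, ℝ) (𝓡 n) σ (Icc 0 1) t (1 : ℝ) : TangentSpace (𝓡 n) (σ t))‖ₑ := by
    intro t ht
    set X : TangentSpace (𝓡 n) (σ t) := mfderivWithin 𝓘(ℝ, ℝ) (𝓡 n) σ (Icc 0 1) t (1 : ℝ) with hX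
    have hu : UniqueDiffWithinAt ℝ (Icc (0 : ℝ) 1) t := uniqueDiffOn_Icc zero_lt_one t ht
    have h1 : HasDerivWithinAt (fun t => ‖g (σ t)‖ ^ 2)
        (mvfderiv (𝓡 n) (fun z => ‖g z‖ ^ 2) (σ t) X) (Icc 0 1) t := by
      have h2 := (hN.contMDiffAt (Metric.isOpen_ball.mem_nhds (hball t ht))).mdifferentiableAt
        (by simp)
      exact h2.hasDerivWithinAt_comp_curve
        (hσ.mdifferentiableOn (by simp) t ht).hasMFDerivWithinAt
    have h5 := (h1.add_const ((δ : ℝ) ^ 2)).sqrt (hpos t).ne'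
    rw [h5.derivWithin hu, ← ofReal_norm, ← ofReal_norm]
    refine ENNReal.ofReal_le_ofReal ?_
    rw [Real.norm_eq_abs, abs_div, abs_of_pos (mul_pos two_pos (Real.sqrt_pos.2 (hpos t))),
      div_le_iff₀ (mul_pos two_pos (Real.sqrt_pos.2 (hpos t)))]
    have h6 := hE.abs_mvfderiv_norm_sq_le hg hgs (hball t ht) X
    have h7 : ‖g (σ t)‖ ≤ Real.sqrt (‖g (σ t)‖ ^ 2 + (δ : ℝ) ^ 2) :=
      Real.le_sqrt_of_sq_le (by nlinarith [sq_nonneg (δ : ℝ)])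
    nlinarith [norm_nonneg X]
  have hint : ‖Real.sqrt (‖g (σ 1)‖ ^ 2 + (δ : ℝ) ^ 2) - Real.sqrt (‖g (σ 0)‖ ^ 2 + (δ : ℝ) ^ 2)‖ₑ
      ≤ pathELength (𝓡 n) σ 0 1 := by
    rw [pathELength_eq_lintegral_mfderivWithin_Icc]
    exact hle.trans (MeasureTheory.setLIntegral_mono' measurableSet_Icc hder)
  have hlow : ‖g (σ 1)‖ ≤ ‖Real.sqrt (‖g (σ 1)‖ ^ 2 + (δ : ℝ) ^ 2)
      - Real.sqrt (‖g (σ 0)‖ ^ 2 + (δ : ℝ) ^ 2)‖ + δ := by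
    have h7 : ‖g (σ 1)‖ ≤ Real.sqrt (‖g (σ 1)‖ ^ 2 + (δ : ℝ) ^ 2) :=
      Real.le_sqrt_of_sq_le (by nlinarith [sq_nonneg (δ : ℝ)])
    have h8 : Real.sqrt (‖g (σ 0)‖ ^ 2 + (δ : ℝ) ^ 2) = δ := by
      rw [h0, hgx]
      simp
    rw [h8]
    have := le_abs_self (Real.sqrt (‖g (σ 1)‖ ^ 2 + (δ : ℝ) ^ 2) - δ)
    rw [Real.norm_eq_abs]
    linarith
  calc ENNReal.ofReal ‖g (σ 1)‖ ≤ ENNReal.ofReal (_ + δ) := ENNReal.ofReal_le_ofReal hlow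
    _ = _ + (δ : ℝ≥0∞) := by
      rw [ENNReal.ofReal_add (norm_nonneg _) hδ'.le, ofReal_norm, ENNReal.ofReal_coe_nnreal]
    _ ≤ _ := by gcongr

variable [IsRiemannianManifold (𝓡 n) M]

theorem IsGeodesicFrom.dist_le {x : M} {v : TangentSpace (𝓡 n) x} {γ : ℝ → M}
    (hγ : IsGeodesicFrom v γ) : dist x (γ 1) ≤ ‖v‖ := by
  have h0 : γ 0 = x := congrArg TotalSpace.proj hγ.2
  have h1 : edist x (γ 1) ≤ pathELength (𝓡 n) γ 0 1 := by
    rw [IsRiemannianManifold.out (I := 𝓡 n) x (γ 1)]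
    exact riemannianEDist_le_pathELength ((hγ.1.1.of_le (by norm_cast)).contMDiffOn) h0 rfl
      zero_le_one
  have h2 : pathELength (𝓡 n) γ 0 1 = ENNReal.ofReal ‖v‖ := by
    rw [pathELength_eq_lintegral_mfderiv_Icc]
    have h3 : ∀ t, ‖(mfderiv 𝓘(ℝ, ℝ) (𝓡 n) γ t (1 : ℝ) : TangentSpace (𝓡 n) (γ t))‖ₑ
        = ENNReal.ofReal ‖v‖ := by
      intro t
      have h4 := hγ.speed_eq t
      rw [real_inner_self_eq_norm_sq, real_inner_self_eq_norm_sq] at h4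
      rw [← ofReal_norm, (pow_left_inj₀ (norm_nonneg _) (norm_nonneg _) two_ne_zero).1 h4]
    have h5 : ∫⁻ t in Icc (0 : ℝ) 1,
        ‖(mfderiv 𝓘(ℝ, ℝ) (𝓡 n) γ t (1 : ℝ) : TangentSpace (𝓡 n) (γ t))‖ₑ
        = ∫⁻ _ in Icc (0 : ℝ) 1, ENNReal.ofReal ‖v‖ := MeasureTheory.lintegral_congr h3
    refine h5.trans ?_
    simp
  rw [h2, edist_dist] at h1
  exact (ENNReal.ofReal_le_ofReal_iff (norm_nonneg _)).1 h1

/-- Inside the injectivity radius, radial geodesics are minimizing. -/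
theorem ExpDiffeoOnBall.norm_eq_dist {x : M} {R : ℝ} (hE : ExpDiffeoOnBall n x R)
    {g : M → TangentSpace (𝓡 n) x} (hg : LeftInvOn g (expMap x) (Metric.ball 0 R))
    (hgs : ContMDiffOn (𝓡 n) 𝓘(ℝ, TangentSpace (𝓡 n) x) ∞ g (Metric.ball x R))
    {y : M} (hy : y ∈ Metric.ball x R) : ‖g y‖ = dist x y := by
  refine le_antisymm (le_of_forall_gt_imp_ge_of_dense fun r hr => ?_) ?_
  · have hy' : dist x y < R := by rw [dist_comm]; exact hy
    have hlt : riemannianEDist (𝓡 n) x y < ENNReal.ofReal (min r R) := by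
      rw [← IsRiemannianManifold.out (I := 𝓡 n) x y, edist_dist]
      exact (ENNReal.ofReal_lt_ofReal_iff_of_nonneg dist_nonneg).2 (lt_min hr hy')
    obtain ⟨σ, h0, h1, hσ, hlen⟩ := exists_lt_of_riemannianEDist_lt hlt
    have hball : ∀ t ∈ Icc (0 : ℝ) 1, σ t ∈ Metric.ball x R := by
      intro t ht
      have := (edist_le_pathELength hσ ht).trans_lt hlen
      rw [h0, edist_dist, ENNReal.ofReal_lt_ofReal_iff_of_nonneg dist_nonneg] at this
      rw [Metric.mem_ball']
      exact this.trans_le (min_le_right _ _)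
    have := (hE.norm_le_of_path hg hgs hσ h0 hball).trans_lt hlen
    rw [h1, ENNReal.ofReal_lt_ofReal_iff_of_nonneg (norm_nonneg _)] at this
    exact (this.trans_le (min_le_left _ _)).le
  · obtain ⟨v, hv, rfl⟩ := hE.1.surjOn hy
    obtain ⟨γ, hγ⟩ := hE.exists_isGeodesicFrom (Metric.pos_of_mem_ball hv) v
    rw [hg hv, hγ.expMap_eq]
    exact hγ.dist_le

end Distance

section InjectivityRadius

variable {n : ℕ} {M : Type*} [MetricSpace M] [ChartedSpace (EuclideanSpace ℝ (Fin n)) M]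
  [RiemannianBundle (fun x : M => TangentSpace (𝓡 n) x)]

theorem exists_expDiffeoOnBall_of_lt {x : M} {r : ℝ}
    (hr : ENNReal.ofReal r < injectivityRadius n x) : ∃ R, r < R ∧ 0 < R ∧ ExpDiffeoOnBall n x R := by
  simp only [injectivityRadius, lt_iSup_iff] at hr
  obtain ⟨R, ⟨hR, hE⟩, hlt⟩ := hr
  exact ⟨R, (ENNReal.ofReal_lt_ofReal_iff hR).1 hlt, hR, hE⟩

variable [IsManifold (𝓡 n) ∞ M] [IsContMDiffRiemannianBundle (𝓡 n) ∞ (EuclideanSpace ℝ (Fin n))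
    (fun x : M => TangentSpace (𝓡 n) x)] [IsRiemannianManifold (𝓡 n) M]

theorem mdifferentiableAt_dist_sq {x y : M} (hy : y ∈ Metric.eball x (injectivityRadius n x)) :
    MDifferentiableAt (𝓡 n) 𝓘(ℝ, ℝ) (fun z => dist z x ^ 2) y := by
  rw [Metric.mem_eball, edist_dist] at hy
  obtain ⟨R, hyR, -, hE⟩ := exists_expDiffeoOnBall_of_lt hy
  obtain ⟨g, hg, hgs⟩ := hE.2.2
  have hmem : Metric.ball x R ∈ 𝓝 y := Metric.isOpen_ball.mem_nhds hyR
  have hgd := (hgs.contMDiffAt hmem).mdifferentiableAt (by simp)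
  have h1 : DifferentiableAt ℝ (fun w : TangentSpace (𝓡 n) x => ‖w‖ ^ 2) (g y) :=
    (contDiff_norm_sq ℝ).differentiable (n := 1) (by simp) _
  have h2 : MDifferentiableAt (𝓡 n) 𝓘(ℝ, ℝ) (fun z => ‖g z‖ ^ 2) y :=
    h1.mdifferentiableAt.comp _ hgd
  refine h2.congr_of_eventuallyEq ?_
  filter_upwards [hmem] with z hz
  rw [hE.norm_eq_dist hg hgs hz, dist_comm]

theorem isCompact_closedBall_of_lt_injectivityRadius {x : M} {r : ℝ}
    (hr : ENNReal.ofReal r < injectivityRadius n x) : IsCompact (Metric.closedBall x r) := by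
  obtain ⟨R, hrR, -, hE⟩ := exists_expDiffeoOnBall_of_lt hr
  obtain ⟨g, hg, hgs⟩ := hE.2.2
  have : FiniteDimensional ℝ (TangentSpace (𝓡 n) x) :=
    inferInstanceAs (FiniteDimensional ℝ (EuclideanSpace ℝ (Fin n)))
  have : ProperSpace (TangentSpace (𝓡 n) x) := FiniteDimensional.proper ℝ _
  have hK : IsCompact (expMap x '' Metric.closedBall (0 : TangentSpace (𝓡 n) x) r) :=
    (isCompact_closedBall _ _).image_of_continuousOn
      (hE.2.1.continuousOn.mono (Metric.closedBall_subset_ball hrR))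
  refine hK.of_isClosed_subset Metric.isClosed_closedBall fun y hy => ?_
  have hyR : y ∈ Metric.ball x R := Metric.closedBall_subset_ball hrR hy
  obtain ⟨v, hv, rfl⟩ := hE.1.surjOn hyR
  refine ⟨v, ?_, rfl⟩
  have h := hE.norm_eq_dist hg hgs hyR
  rw [hg hv] at h
  rw [mem_closedBall_zero_iff, h]
  exact Metric.mem_closedBall'.1 hy

theorem IsGeodesicFrom.dist_eq {x : M} {v : TangentSpace (𝓡 n) x} {γ : ℝ → M}
    (hγ : IsGeodesicFrom v γ) (hv : ‖v‖ = 1) {t : ℝ} (ht : 0 ≤ t)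
    (hti : ENNReal.ofReal t < injectivityRadius n x) : dist x (γ t) = t := by
  obtain ⟨R, hrR, -, hE⟩ := exists_expDiffeoOnBall_of_lt hti
  obtain ⟨g, hg, hgs⟩ := hE.2.2
  have hmem : t • v ∈ Metric.ball (0 : TangentSpace (𝓡 n) x) R := by
    simpa [norm_smul, hv, abs_of_nonneg ht] using hrR
  have h := hE.norm_eq_dist hg hgs (hE.1.mapsTo hmem)
  rw [hg hmem, hγ.expMap_smul] at h
  rw [← h, norm_smul, hv, Real.norm_of_nonneg ht, mul_one]

theorem inradiusAt_le_injectivityRadius (hn : 0 < n) {x : M} {D : Set M} (hx : x ∈ D)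
    (hD : D ⊆ Metric.eball x (injectivityRadius n x)) :
    inradiusAt x D ≤ injectivityRadius n x := by
  refine iSup₂_le fun r hr => ?_
  by_contra! hlt
  have hi0 : 0 < injectivityRadius n x := by
    simpa using Metric.mem_eball.1 (hD hx)
  have hfin : injectivityRadius n x ≠ ⊤ := (hlt.trans ENNReal.ofReal_lt_top).ne
  set i := (injectivityRadius n x).toReal with hi
  have hieq : ENNReal.ofReal i = injectivityRadius n x := ENNReal.ofReal_toReal hfin
  have hipos : 0 < i := ENNReal.toReal_pos hi0.ne' hfin
  have hir : i < r := by
    rw [← hieq] at hlt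
    exact (ENNReal.ofReal_lt_ofReal_iff hr.1).1 hlt
  have : Nonempty (Fin n) := ⟨⟨0, hn⟩⟩
  have : Nontrivial (TangentSpace (𝓡 n) x) :=
    inferInstanceAs (Nontrivial (EuclideanSpace ℝ (Fin n)))
  obtain ⟨v, hv⟩ := exists_norm_eq (TangentSpace (𝓡 n) x) (zero_le_one' ℝ)
  obtain ⟨R, -, hR, hE⟩ := exists_expDiffeoOnBall_of_lt (r := 0) (by simpa using hi0)
  obtain ⟨γ, hγ⟩ := hE.exists_isGeodesicFrom hR v
  have hcont : Continuous fun t => dist x (γ t) := continuous_const.dist hγ.1.1.continuous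
  have heq : EqOn (fun t => dist x (γ t)) id (Ico 0 i) := by
    intro t ht
    refine hγ.dist_eq hv ht.1 ?_
    rw [← hieq]
    exact (ENNReal.ofReal_lt_ofReal_iff hipos).2 ht.2
  have hdi : dist x (γ i) = i := by
    have h := heq.closure hcont continuous_id
    rw [closure_Ico hipos.ne] at h
    exact h ⟨hipos.le, le_rfl⟩
  have hmem := hD (hr.2 (Metric.mem_ball'.2 (hdi.trans_lt hir)))
  rw [Metric.mem_eball', edist_dist, hdi, hieq] at hmem
  exact lt_irrefl _ hmem

end InjectivityRadius

section Existence

/-- The Picard-Lindelöf theorem, with the additional information that the solution stays in the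
ball on which the vector field is controlled. -/
theorem IsPicardLindelof.exists_mem_closedBall_hasDerivWithinAt {E : Type*} [NormedAddCommGroup E]
    [NormedSpace ℝ E] [CompleteSpace E] {f : ℝ → E → E} {tmin tmax : ℝ} {t₀ : Icc tmin tmax}
    {x₀ x : E} {a r L K : ℝ≥0} (hf : IsPicardLindelof f t₀ x₀ a r L K)
    (hx : x ∈ Metric.closedBall x₀ r) :
    ∃ α : ℝ → E, α t₀ = x ∧ ∀ t ∈ Icc tmin tmax,
      α t ∈ Metric.closedBall x₀ a ∧ HasDerivWithinAt α (f t (α t)) (Icc tmin tmax) t := by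
  obtain ⟨α, hα⟩ := ODE.FunSpace.exists_isFixedPt_next hf hx
  refine ⟨α.compProj, by rw [ODE.FunSpace.compProj_val, ← hα, ODE.FunSpace.next_apply₀],
    fun t ht => ⟨α.compProj_mem_closedBall hf.mul_max_le, ?_⟩⟩
  refine (ODE.hasDerivWithinAt_picard_Icc t₀.2 hf.continuousOn_uncurry
    α.continuous_compProj.continuousOn (fun _ _ => α.compProj_mem_closedBall hf.mul_max_le)
    x ht).congr_of_mem ?_ ht
  intro t' ht'
  nth_rw 1 [← hα]
  rw [ODE.FunSpace.compProj_of_mem ht', ODE.FunSpace.next_apply]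

variable {n : ℕ} {M : Type*} [MetricSpace M] [ChartedSpace (EuclideanSpace ℝ (Fin n)) M]
  {f : ℝ → (x : M) → TangentSpace (𝓡 n) x} {D : Set M}

theorem hasMFDerivWithinAt_congr_solution {x z : ℝ → M} {J J' : Set ℝ} {t : ℝ}
    (h : HasMFDerivWithinAt 𝓘(ℝ, ℝ) (𝓡 n) x J t ((1 : ℝ →L[ℝ] ℝ).smulRight (f t (x t))))
    (heq : EqOn z x J) (ht : z t = x t) (hJ : J ∈ 𝓝[J'] t) :
    HasMFDerivWithinAt 𝓘(ℝ, ℝ) (𝓡 n) z J' t ((1 : ℝ →L[ℝ] ℝ).smulRight (f t (z t))) := by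
  have h1 := (h.congr_of_eventuallyEq (heq.eventuallyEq_of_mem self_mem_nhdsWithin)
    ht).mono_of_mem_nhdsWithin hJ
  have h2 : (f t (z t) : EuclideanSpace ℝ (Fin n)) = f t (x t) :=
    congrArg (fun y => (f t y : EuclideanSpace ℝ (Fin n))) ht
  have h3 := congrArg (fun w : EuclideanSpace ℝ (Fin n) => (1 : ℝ →L[ℝ] ℝ).smulRight w) h2
  exact h1.congr_mfderiv h3.symm

theorem IsSolutionOn.mono {x : ℝ → M} {J J' : Set ℝ} (h : IsSolutionOn f D x J) (hJ : J' ⊆ J) :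
    IsSolutionOn f D x J' := fun t ht => ⟨(h t (hJ ht)).1, (h t (hJ ht)).2.mono hJ⟩

theorem IsSolutionOn.continuousOn {x : ℝ → M} {J : Set ℝ} (h : IsSolutionOn f D x J) :
    ContinuousOn x J := fun t ht => (h t ht).2.continuousWithinAt

theorem IsSolutionOn.glue {x y : ℝ → M} {a b c : ℝ} (hab : a ≤ b) (hbc : b ≤ c)
    (hx : IsSolutionOn f D x (Icc a b)) (hy : IsSolutionOn f D y (Icc b c)) (hxy : y b = x b) :
    ∃ z : ℝ → M, IsSolutionOn f D z (Icc a c) ∧ EqOn z x (Icc a b) := by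
  classical
  let z : ℝ → M := fun t => if t ≤ b then x t else y t
  have hzx : EqOn z x (Icc a b) := fun t ht => if_pos ht.2
  have hzy : EqOn z y (Icc b c) := by
    intro t ht
    rcases ht.1.eq_or_lt with rfl | h
    · exact (if_pos le_rfl).trans hxy.symm
    · exact if_neg h.not_ge
  refine ⟨z, fun t ht => ?_, hzx⟩
  rcases lt_trichotomy t b with h | rfl | h
  · have htm : t ∈ Icc a b := ⟨ht.1, h.le⟩
    refine ⟨hzx htm ▸ (hx t htm).1, hasMFDerivWithinAt_congr_solution (hx t htm).2 hzx (hzx htm) ?_⟩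
    filter_upwards [self_mem_nhdsWithin, mem_nhdsWithin_of_mem_nhds (Iio_mem_nhds h)] with s h1 h2
    exact ⟨h1.1, le_of_lt h2⟩
  · have h1 : t ∈ Icc a t := ⟨hab, le_rfl⟩
    have h2 : t ∈ Icc t c := ⟨le_rfl, hbc⟩
    refine ⟨hzx h1 ▸ (hx t h1).1, ?_⟩
    rw [← Icc_union_Icc_eq_Icc hab hbc]
    exact (hasMFDerivWithinAt_congr_solution (hx t h1).2 hzx (hzx h1) self_mem_nhdsWithin).union
      (hasMFDerivWithinAt_congr_solution (hy t h2).2 hzy (hzy h2) self_mem_nhdsWithin)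
  · have htm : t ∈ Icc b c := ⟨h.le, ht.2⟩
    refine ⟨hzy htm ▸ (hy t htm).1, hasMFDerivWithinAt_congr_solution (hy t htm).2 hzy (hzy htm) ?_⟩
    filter_upwards [self_mem_nhdsWithin, mem_nhdsWithin_of_mem_nhds (Ioi_mem_nhds h)] with s h1 h2
    exact ⟨le_of_lt h2, h1.2⟩

variable [IsManifold (𝓡 n) ∞ M]

theorem hasMFDerivWithinAt_extChartAt_symm_comp (p : M) {α : ℝ → EuclideanSpace ℝ (Fin n)}
    {J : Set ℝ} {t : ℝ} (hα : α t ∈ (extChartAt (𝓡 n) p).target)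
    (X : TangentSpace (𝓡 n) ((extChartAt (𝓡 n) p).symm (α t)))
    (h : HasDerivWithinAt α (mvfderiv (𝓡 n) (extChartAt (𝓡 n) p)
      ((extChartAt (𝓡 n) p).symm (α t)) X) J t) :
    HasMFDerivWithinAt 𝓘(ℝ, ℝ) (𝓡 n) (fun s => (extChartAt (𝓡 n) p).symm (α s)) J t
      ((1 : ℝ →L[ℝ] ℝ).smulRight X) := by
  have h1 : MDifferentiableAt 𝓘(ℝ, EuclideanSpace ℝ (Fin n)) (𝓡 n) (extChartAt (𝓡 n) p).symm (α t) :=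
    ((contMDiffOn_extChartAt_symm (n := ∞) p).contMDiffAt
      ((isOpen_extChartAt_target p).mem_nhds hα)).mdifferentiableAt (by simp)
  have h2 := h1.hasMFDerivAt.comp_hasMFDerivWithinAt t h.hasFDerivWithinAt.hasMFDerivWithinAt
  have h3 : chartFrame p (α t) ∘L (ContinuousLinearMap.toSpanSingleton ℝ (mvfderiv (𝓡 n)
      (extChartAt (𝓡 n) p) ((extChartAt (𝓡 n) p).symm (α t)) X))
      = (1 : ℝ →L[ℝ] ℝ).smulRight X := by
    ext
    change chartFrame p (α t) ((1 : ℝ) • mvfderiv (𝓡 n) (extChartAt (𝓡 n) p)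
      ((extChartAt (𝓡 n) p).symm (α t)) X) = (1 : ℝ) • X
    rw [one_smul, one_smul]
    exact chartFrame_mvfderiv_extChartAt p hα X
  exact h2.congr_mfderiv h3

theorem IsContLocLipschitz.exists_local_solution (hf : IsContLocLipschitz f D) {p : M} (hp : p ∈ D)
    (T : ℝ) : ∃ U ∈ 𝓝 p, ∃ ε > 0, ∀ x₀ ∈ U, ∀ t₀ ∈ Icc 0 T,
      ∃ x : ℝ → M, IsSolutionOn f D x (Icc t₀ (t₀ + ε)) ∧ x t₀ = x₀ := by
  obtain ⟨L, U, hU, hUs, hUD, hL⟩ := hf.2 p hp (T + 1)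
  set φ := extChartAt (𝓡 n) p with hφ
  let F : ℝ → EuclideanSpace ℝ (Fin n) → EuclideanSpace ℝ (Fin n) := fun t u =>
    mvfderiv (𝓡 n) φ (φ.symm u) (f t (φ.symm u))
  have hnhds : φ.target ∩ φ.symm ⁻¹' U ∈ 𝓝 (φ p) := by
    refine inter_mem (extChartAt_target_mem_nhds p) ?_
    refine (continuousAt_extChartAt_symm p).preimage_mem_nhds ?_
    rwa [extChartAt_to_inv]
  obtain ⟨a, ha, hball⟩ := Metric.nhds_basis_closedBall.mem_iff.1 hnhds
  have hcont : ∀ u ∈ Metric.closedBall (φ p) a, ContinuousOn (fun t => F t u) (Icc 0 (T + 1)) := by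
    intro u hu
    exact (mvfderiv (𝓡 n) φ (φ.symm u)).continuous.comp_continuousOn
      ((hf.1 _ (hUD (hball hu).2)).mono Icc_subset_Ici_self)
  have hlip : ∀ t ∈ Icc 0 (T + 1), ∀ u ∈ Metric.closedBall (φ p) a,
      ∀ w ∈ Metric.closedBall (φ p) a, ‖F t u - F t w‖ ≤ |L| * ‖u - w‖ := by
    intro t ht u hu w hw
    have := hL t ht _ (hball hu).2 _ (hball hw).2
    rw [φ.right_inv (hball hu).1, φ.right_inv (hball hw).1] at this
    exact this.trans (mul_le_mul_of_nonneg_right (le_abs_self L) (norm_nonneg _))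
  obtain ⟨C, hC⟩ := isCompact_Icc.exists_bound_of_continuousOn
    (hcont (φ p) (Metric.mem_closedBall_self ha.le))
  set B : ℝ := |C| + |L| * a with hB
  have hB0 : 0 ≤ B := by positivity
  have hbd : ∀ t ∈ Icc 0 (T + 1), ∀ u ∈ Metric.closedBall (φ p) a, ‖F t u‖ ≤ B := by
    intro t ht u hu
    have h1 := hlip t ht u hu (φ p) (Metric.mem_closedBall_self ha.le)
    have h2 : ‖u - φ p‖ ≤ a := by simpa [dist_eq_norm] using hu
    have h3 := norm_add_le (F t u - F t (φ p)) (F t (φ p))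
    rw [sub_add_cancel] at h3
    have h4 := mul_le_mul_of_nonneg_left h2 (abs_nonneg L)
    linarith [hC t ht, le_abs_self C]
  set ε : ℝ := min 1 (a / 2 / (B + 1)) with hε
  have hε0 : 0 < ε := lt_min one_pos (by positivity)
  refine ⟨φ.source ∩ φ ⁻¹' Metric.closedBall (φ p) (a / 2), inter_mem (extChartAt_source_mem_nhds p)
    ((continuousAt_extChartAt p).preimage_mem_nhds (Metric.closedBall_mem_nhds _ (by positivity))),
    ε, hε0, fun x₀ hx₀ t₀ ht₀ => ?_⟩
  have hIcc : Icc t₀ (t₀ + ε) ⊆ Icc 0 (T + 1) :=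
    Icc_subset_Icc ht₀.1 (add_le_add ht₀.2 (min_le_left _ _))
  have hPL : IsPicardLindelof F (⟨t₀, le_rfl, by linarith⟩ : Icc t₀ (t₀ + ε)) (φ p) ⟨a, ha.le⟩
      ⟨a / 2, by positivity⟩ ⟨B, hB0⟩ ⟨|L|, abs_nonneg L⟩ := by
    refine ⟨fun t ht => ?_, fun u hu => (hcont u hu).mono hIcc,
      fun t ht u hu => hbd t (hIcc ht) u hu, ?_⟩
    · refine LipschitzOnWith.of_dist_le_mul fun u hu w hw => ?_
      rw [dist_eq_norm, dist_eq_norm]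
      exact hlip t (hIcc ht) u hu w hw
    · change B * max (t₀ + ε - t₀) (t₀ - t₀) ≤ a - a / 2
      rw [add_sub_cancel_left, sub_self, max_eq_left hε0.le]
      have h1 : ε ≤ a / 2 / (B + 1) := min_le_right _ _
      rw [le_div_iff₀ (by positivity)] at h1
      nlinarith
  obtain ⟨α, hα0, hα⟩ := hPL.exists_mem_closedBall_hasDerivWithinAt (x := φ x₀) hx₀.2
  refine ⟨fun t => φ.symm (α t), fun t ht => ?_, ?_⟩
  · have hm := hball (hα t ht).1
    exact ⟨hUD hm.2, hasMFDerivWithinAt_extChartAt_symm_comp p hm.1 _ (hα t ht).2⟩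
  · change φ.symm (α t₀) = x₀
    rw [hα0, φ.left_inv hx₀.1]

theorem IsContLocLipschitz.exists_uniform_local_solution (hf : IsContLocLipschitz f D) {K : Set M}
    (hK : IsCompact K) (hKD : K ⊆ D) (T : ℝ) :
    ∃ ε > 0, ∀ x₀ ∈ K, ∀ t₀ ∈ Icc 0 T,
      ∃ x : ℝ → M, IsSolutionOn f D x (Icc t₀ (t₀ + ε)) ∧ x t₀ = x₀ := by
  refine hK.induction_on (p := fun S => ∃ ε > 0, ∀ x₀ ∈ S, ∀ t₀ ∈ Icc 0 T,
      ∃ x : ℝ → M, IsSolutionOn f D x (Icc t₀ (t₀ + ε)) ∧ x t₀ = x₀) ?_ ?_ ?_ ?_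
  · exact ⟨1, one_pos, fun x₀ h => absurd h (notMem_empty _)⟩
  · rintro s t hst ⟨ε, hε, h⟩
    exact ⟨ε, hε, fun x₀ hx₀ => h x₀ (hst hx₀)⟩
  · rintro s t ⟨ε, hε, h⟩ ⟨ε', hε', h'⟩
    refine ⟨min ε ε', lt_min hε hε', ?_⟩
    rintro x₀ (hx₀ | hx₀) t₀ ht₀
    · obtain ⟨x, hx, hx0⟩ := h x₀ hx₀ t₀ ht₀
      exact ⟨x, hx.mono (Icc_subset_Icc_right (by gcongr; exact min_le_left _ _)), hx0⟩
    · obtain ⟨x, hx, hx0⟩ := h' x₀ hx₀ t₀ ht₀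
      exact ⟨x, hx.mono (Icc_subset_Icc_right (by gcongr; exact min_le_right _ _)), hx0⟩
  · intro p hp
    obtain ⟨U, hU, ε, hε, h⟩ := hf.exists_local_solution (hKD hp) T
    exact ⟨U, mem_nhdsWithin_of_mem_nhds hU, ε, hε, h⟩

/-- A solution that is known to remain in a compact subset of `D` can be extended by a time span
of length one. -/
theorem IsContLocLipschitz.exists_extension (hf : IsContLocLipschitz f D) {K : Set M}
    (hK : IsCompact K) (hKD : K ⊆ D) {t₀ : ℝ} (ht₀ : 0 ≤ t₀) {x₀ : M} (hx₀ : x₀ ∈ K)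
    (hinv : ∀ (T : ℝ) (x : ℝ → M), IsSolutionOn f D x (Ico t₀ T) → x t₀ = x₀ →
      ∀ t ∈ Ico t₀ T, x t ∈ K) {b : ℝ} (hb : t₀ ≤ b) {x : ℝ → M}
    (hx : IsSolutionOn f D x (Icc t₀ b)) (hx0 : x t₀ = x₀) :
    ∃ z : ℝ → M, IsSolutionOn f D z (Icc t₀ (b + 1)) ∧ EqOn z x (Icc t₀ b) := by
  obtain ⟨ε, hε, hloc⟩ := hf.exists_uniform_local_solution hK hKD (b + 1)
  obtain ⟨N, hN⟩ := exists_nat_one_div_lt hε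
  have hN0 : (0 : ℝ) < N + 1 := by positivity
  have key : ∀ k : ℕ, k ≤ N + 1 → ∃ z : ℝ → M,
      IsSolutionOn f D z (Icc t₀ (b + k * (1 / (N + 1)))) ∧ EqOn z x (Icc t₀ b) := by
    intro k
    induction k with
    | zero => exact fun _ => ⟨x, by simpa using hx, fun _ _ => rfl⟩
    | succ k ih =>
      intro hk
      obtain ⟨z, hz, hzx⟩ := ih (by omega)
      set c := b + k * (1 / ((N : ℝ) + 1)) with hc
      have hbc : b ≤ c := le_add_of_nonneg_right (by positivity)
      have hcb : c ≤ b + 1 := by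
        have h1 : (k : ℝ) ≤ N + 1 := by exact_mod_cast (by omega : k ≤ N + 1)
        rw [hc, mul_one_div]
        gcongr
        exact (div_le_one hN0).2 h1
      have hz0 : z t₀ = x₀ := (hzx ⟨le_rfl, hb⟩).trans hx0
      have hzc : z c ∈ K := by
        rcases (hb.trans hbc).eq_or_lt with h | h
        · rw [← h, hz0]
          exact hx₀
        · have h1 : ContinuousWithinAt z (Ico t₀ c) c :=
            (hz.continuousOn c ⟨h.le, le_rfl⟩).mono Ico_subset_Icc_self
          have h2 : c ∈ closure (Ico t₀ c) := by
            rw [closure_Ico h.ne]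
            exact ⟨h.le, le_rfl⟩
          refine hK.isClosed.closure_subset_iff.2 ?_ (h1.mem_closure_image h2)
          rintro _ ⟨t, ht, rfl⟩
          exact hinv c z (hz.mono Ico_subset_Icc_self) hz0 t ht
      obtain ⟨y, hy, hyc⟩ := hloc (z c) hzc c ⟨ht₀.trans (hb.trans hbc), hcb⟩
      have hstep : c + 1 / ((N : ℝ) + 1) ≤ c + ε := by gcongr
      obtain ⟨w, hw, hwz⟩ := hz.glue (c := c + 1 / ((N : ℝ) + 1)) (hb.trans hbc)
        (le_add_of_nonneg_right (by positivity)) (hy.mono (Icc_subset_Icc_right hstep)) hyc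
      refine ⟨w, ?_, fun t ht => (hwz ⟨ht.1, ht.2.trans hbc⟩).trans (hzx ht)⟩
      have : b + ((k + 1 : ℕ) : ℝ) * (1 / ((N : ℝ) + 1)) = c + 1 / ((N : ℝ) + 1) := by
        rw [hc]
        push_cast
        ring
      rwa [this]
  obtain ⟨z, hz, hzx⟩ := key (N + 1) le_rfl
  refine ⟨z, ?_, hzx⟩
  have : ((N + 1 : ℕ) : ℝ) * (1 / ((N : ℝ) + 1)) = 1 := by
    push_cast
    field_simp
  rwa [this] at hz

/-- If all solutions starting at `x₀` at time `t₀` remain in a compact subset of `D`, then there is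
one defined for all later times. -/
theorem IsContLocLipschitz.exists_global_solution (hf : IsContLocLipschitz f D) {K : Set M}
    (hK : IsCompact K) (hKD : K ⊆ D) {t₀ : ℝ} (ht₀ : 0 ≤ t₀) {x₀ : M} (hx₀ : x₀ ∈ K)
    (hinv : ∀ (T : ℝ) (x : ℝ → M), IsSolutionOn f D x (Ico t₀ T) → x t₀ = x₀ →
      ∀ t ∈ Ico t₀ T, x t ∈ K) :
    ∃ x : ℝ → M, IsSolutionOn f D x (Ici t₀) ∧ x t₀ = x₀ := by
  obtain ⟨ε, hε, hloc⟩ := hf.exists_uniform_local_solution hK hKD t₀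
  obtain ⟨y, hy, hy0⟩ := hloc x₀ hx₀ t₀ ⟨ht₀, le_rfl⟩
  let S : ℕ → Type _ := fun k => {x : ℝ → M // IsSolutionOn f D x (Icc t₀ (t₀ + k)) ∧ x t₀ = x₀}
  have hstep : ∀ (k : ℕ) (x : S k), ∃ z : S (k + 1), EqOn z.1 x.1 (Icc t₀ (t₀ + k)) := by
    rintro k ⟨x, hx, hx0⟩
    have hk : t₀ ≤ t₀ + k := le_add_of_nonneg_right (Nat.cast_nonneg k)
    obtain ⟨z, hz, hzx⟩ := hf.exists_extension hK hKD ht₀ hx₀ hinv hk hx hx0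
    exact ⟨⟨z, by push_cast; rwa [← add_assoc], (hzx ⟨le_rfl, hk⟩).trans hx0⟩, hzx⟩
  choose next hnext using hstep
  let X : (k : ℕ) → S k := fun k => Nat.rec
    ⟨y, hy.mono (Icc_subset_Icc_right (by simpa using hε.le)), hy0⟩ next k
  have hX : ∀ k m : ℕ, k ≤ m → EqOn (X m).1 (X k).1 (Icc t₀ (t₀ + k)) := by
    intro k m hkm
    induction m, hkm using Nat.le_induction with
    | base => exact fun _ _ => rfl
    | succ m hkm ih =>
      intro t ht
      have hkm' : (k : ℝ) ≤ m := by exact_mod_cast hkm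
      exact (hnext m (X m) ⟨ht.1, ht.2.trans (by gcongr)⟩).trans (ih ht)
  let x : ℝ → M := fun t => (X (⌊t - t₀⌋₊ + 1)).1 t
  have hxX : ∀ m : ℕ, EqOn x (X m).1 (Ico t₀ (t₀ + m)) := by
    intro m t ht
    have h1 : ⌊t - t₀⌋₊ + 1 ≤ m := by
      rw [Nat.add_one_le_iff, Nat.floor_lt (by linarith [ht.1])]
      linarith [ht.2]
    refine (hX _ _ h1 ⟨ht.1, ?_⟩).symm
    have := (Nat.lt_floor_add_one (t - t₀)).le
    push_cast
    linarith
  refine ⟨x, fun t ht => ?_, ?_⟩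
  · set m := ⌊t - t₀⌋₊ + 1 with hm
    have htm : t < t₀ + m := by
      have := Nat.lt_floor_add_one (t - t₀)
      rw [hm]
      push_cast
      linarith
    have hmem : t ∈ Ico t₀ (t₀ + m) := ⟨ht, htm⟩
    have hsol := (X m).2.1.mono (Ico_subset_Icc_self)
    refine ⟨hxX m hmem ▸ (hsol t hmem).1,
      hasMFDerivWithinAt_congr_solution (hsol t hmem).2 (hxX m) (hxX m hmem) ?_⟩
    filter_upwards [self_mem_nhdsWithin, mem_nhdsWithin_of_mem_nhds (Iio_mem_nhds htm)]
      with s h1 h2 using ⟨h1, h2⟩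
  · have h0 : t₀ ∈ Ico t₀ (t₀ + ((1 : ℕ) : ℝ)) := ⟨le_rfl, by simp⟩
    exact (hxX 1 h0).trans (X 1).2.2

end Existence

section ComparisonFunctions

theorem lipschitzWith_iInf {ι Y : Type*} [Nonempty ι] [PseudoMetricSpace Y] {F : ι → Y → ℝ} {C : ℝ≥0}
    (hF : ∀ i, LipschitzWith C (F i)) (h0 : ∀ i y, 0 ≤ F i y) :
    LipschitzWith C fun y => ⨅ i, F i y := by
  refine LipschitzWith.of_le_add_mul C fun y z => ?_
  rw [← sub_le_iff_le_add]
  refine le_ciInf fun i => ?_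
  rw [sub_le_iff_le_add]
  exact (ciInf_le ⟨0, by rintro _ ⟨j, rfl⟩; exact h0 j y⟩ i).trans ((hF i).le_add_mul y z)

variable {X : Type*} [TopologicalSpace X] {B : Set X}

theorem iInf_pos_of_compact_core {F : X → ℝ} (hB : B.Nonempty) (hF : ContinuousOn F B)
    (hpos : ∀ x ∈ B, 0 < F x) {K : Set X} (hKB : K ⊆ B) (hK : IsCompact K)
    (hout : ∀ x ∈ B, x ∉ K → 1 ≤ F x) : 0 < ⨅ x : B, F x := by
  have : Nonempty B := hB.to_subtype
  rcases K.eq_empty_or_nonempty with rfl | hne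
  · exact one_pos.trans_le (le_ciInf fun x => hout x x.2 (notMem_empty _))
  · obtain ⟨y, hy, hmin⟩ := hK.exists_isMinOn hne (hF.mono hKB)
    refine (lt_min one_pos (hpos y (hKB hy))).trans_le (le_ciInf fun x => ?_)
    by_cases hx : (x : X) ∈ K
    · exact (min_le_right _ _).trans (hmin hx)
    · exact (min_le_left _ _).trans (hout x x.2 hx)

theorem lipschitzWith_max_sub_zero (c : ℝ) : LipschitzWith 1 fun s : ℝ => max (s - c) 0 := by
  refine LipschitzWith.of_le_add fun s t => ?_
  rw [Real.dist_eq]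
  refine max_le ?_ (add_nonneg (le_max_right _ _) (abs_nonneg _))
  linarith [le_max_left (t - c) 0, le_abs_self (s - t)]

/-- If `p` vanishes where `q` does, and the sublevel sets of `q` are relatively compact, then `q`
dominates an increasing homeomorphism of `p`. -/
theorem exists_orderIso_comp_le {p q : X → ℝ} (hp : ContinuousOn p B) (hq : ContinuousOn q B)
    (hp0 : ∀ x ∈ B, 0 ≤ p x) (hq0 : ∀ x ∈ B, 0 ≤ q x) (hpq : ∀ x ∈ B, q x = 0 → p x = 0)
    {x₀ : X} (hx₀ : x₀ ∈ B)
    (hK : ∀ c : ℝ, ∃ K ⊆ B, IsCompact K ∧ ∀ x ∈ B, q x ≤ c → x ∈ K) :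
    ∃ e : ℝ ≃o ℝ, e 0 = 0 ∧ ∀ x ∈ B, e (p x) ≤ q x := by
  have : Nonempty B := ⟨⟨x₀, hx₀⟩⟩
  let F : B → ℝ → ℝ := fun x s => q x + max (s - p x) 0
  have hF0 : ∀ x s, 0 ≤ F x s := fun x s => add_nonneg (hq0 x x.2) (le_max_right _ _)
  have hbdd : ∀ s, BddBelow (range fun x => F x s) := fun s =>
    ⟨0, by rintro _ ⟨x, rfl⟩; exact hF0 x s⟩
  let m : ℝ → ℝ := fun s => ⨅ x, F x s
  have hmc : Continuous m := (lipschitzWith_iInf (C := 1) (F := F)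
    (fun x => by simpa using (LipschitzWith.const (q x)).add (lipschitzWith_max_sub_zero (p x)))
    hF0).continuous
  have hm0 : ∀ s, 0 ≤ m s := fun s => le_ciInf fun x => hF0 x s
  have hmono : Monotone m := fun s t hst =>
    ciInf_mono (hbdd s) fun x => by simp only [F]; gcongr
  have hmle : ∀ x ∈ B, m (p x) ≤ q x := fun x hx =>
    (ciInf_le (hbdd _) ⟨x, hx⟩).trans (by simp [F])
  have hmpos : ∀ s, 0 < s → 0 < m s := by
    intro s hs
    obtain ⟨K, hKB, hKc, hKq⟩ := hK 1
    refine iInf_pos_of_compact_core (F := fun x => q x + max (s - p x) 0) ⟨x₀, hx₀⟩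
      (hq.add ((continuousOn_const.sub hp).sup continuousOn_const)) (fun x hx => ?_) hKB hKc
      fun x hx hxK => ?_
    · rcases (hq0 x hx).eq_or_lt with h | h
      · rw [← h, hpq x hx h.symm]
        simpa using hs
      · exact add_pos_of_pos_of_nonneg h (le_max_right _ _)
    · have h1 : 1 < q x := by
        by_contra hle
        exact hxK (hKq x hx (not_lt.1 hle))
      exact h1.le.trans (le_add_of_nonneg_right (le_max_right _ _))
  have hmtop : Tendsto m atTop atTop := by
    refine tendsto_atTop.2 fun c => ?_
    obtain ⟨K, hKB, hKc, hKq⟩ := hK c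
    obtain ⟨P, hP⟩ := hKc.bddAbove_image (hp.mono hKB)
    filter_upwards [eventually_ge_atTop (P + c)] with s hs
    refine le_ciInf fun x => ?_
    by_cases hx : (x : X) ∈ K
    · have h1 : p x ≤ P := hP (mem_image_of_mem p hx)
      have h2 := le_max_left (s - p x) 0
      have h3 := hq0 x x.2
      simp only [F]
      linarith
    · have h1 : c < q x := by
        by_contra hle
        exact hx (hKq x x.2 (not_lt.1 hle))
      exact h1.le.trans (le_add_of_nonneg_right (le_max_right _ _))
  let θ : ℝ → ℝ := fun s => max s 0 / (1 + max s 0)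
  have hden : ∀ s : ℝ, 0 < 1 + max s 0 := fun s => by positivity
  have hθc : Continuous θ := (continuous_id.max continuous_const).div
    (continuous_const.add (continuous_id.max continuous_const)) fun s => (hden s).ne'
  have hθ0 : ∀ s, 0 ≤ θ s := fun s => by positivity
  have hθ1 : ∀ s, θ s ≤ 1 := fun s => (div_le_one (hden s)).2 (by linarith)
  have hθneg : ∀ s, s ≤ 0 → θ s = 0 := fun s hs => by simp [θ, max_eq_right hs]
  have hθlt : ∀ s t, 0 ≤ s → s < t → θ s < θ t := by
    intro s t hs hst
    simp only [θ, max_eq_left hs, max_eq_left (hs.trans hst.le)]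
    rw [div_lt_div_iff₀ (by linarith) (by linarith)]
    nlinarith
  let h : ℝ → ℝ := fun s => m s * θ s + min s 0
  have hc : Continuous h := (hmc.mul hθc).add (continuous_id.min continuous_const)
  have hneg : ∀ s, s ≤ 0 → h s = s := fun s hs => by simp [h, hθneg s hs, min_eq_left hs]
  have hnn : ∀ s, 0 ≤ s → h s = m s * θ s := fun s hs => by simp [h, min_eq_right hs]
  have hstrict : StrictMono h := by
    intro s t hst
    rcases lt_or_ge s 0 with hs | hs
    · rw [hneg s hs.le]
      have h1 : s < min t 0 := lt_min hst hs
      have h2 : 0 ≤ m t * θ t := mul_nonneg (hm0 t) (hθ0 t)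
      simp only [h]
      linarith
    · rw [hnn s hs, hnn t (hs.trans hst.le)]
      exact (mul_le_mul_of_nonneg_right (hmono hst.le) (hθ0 s)).trans_lt
        (mul_lt_mul_of_pos_left (hθlt s t hs hst) (hmpos t (hs.trans_lt hst)))
  have htop : Tendsto h atTop atTop := by
    refine tendsto_atTop_mono' _ ?_ (hmtop.atTop_div_const two_pos)
    filter_upwards [eventually_ge_atTop 1] with s hs
    rw [hnn s (zero_le_one.trans hs), div_eq_mul_inv]
    refine mul_le_mul_of_nonneg_left ?_ (hm0 s)
    simp only [θ, max_eq_left (zero_le_one.trans hs)]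
    rw [inv_eq_one_div, div_le_div_iff₀ two_pos (by linarith)]
    linarith
  have hbot : Tendsto h atBot atBot := by
    refine tendsto_id.congr' ?_
    filter_upwards [eventually_le_atBot 0] with s hs using (hneg s hs).symm
  refine ⟨hstrict.orderIsoOfSurjective h (hc.surjective htop hbot), hneg 0 le_rfl, fun x hx => ?_⟩
  change h (p x) ≤ q x
  rw [hnn _ (hp0 x hx)]
  exact (mul_le_of_le_one_right (hm0 _) (hθ1 _)).trans (hmle x hx)

end ComparisonFunctions

section ImplicitDecay

/-- The properties of a decay rate `η a s`, valid for levels between `s` and `a`. -/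
structure IsDecayRate (η : ℝ → ℝ → ℝ) : Prop where
  continuous : Continuous (Function.uncurry η)
  mono : ∀ a, Monotone (η a)
  anti : ∀ s, Antitone fun a => η a s
  zero : ∀ a, 0 ≤ a → η a 0 = 0
  pos : ∀ a s, 0 < s → 0 < η a s

theorem IsDecayRate.strictMono {η : ℝ → ℝ → ℝ} (hη : IsDecayRate η) (a : ℝ) {τ : ℝ} (hτ : 0 ≤ τ) :
    StrictMono fun s => s + η a s * τ := fun _ _ hst =>
  add_lt_add_of_lt_of_le hst (mul_le_mul_of_nonneg_right (hη.mono a hst.le) hτ)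

theorem IsDecayRate.exists_level {η : ℝ → ℝ → ℝ} (hη : IsDecayRate η) {a τ : ℝ} (ha : 0 ≤ a)
    (hτ : 0 ≤ τ) : ∃ s, 0 ≤ s ∧ s ≤ a ∧ s + η a s * τ = a := by
  have hc : Continuous fun s => s + η a s * τ :=
    continuous_id.add ((hη.continuous.comp (Continuous.prodMk_right a)).mul continuous_const)
  have h0 : 0 + η a 0 * τ ≤ a := by simpa [hη.zero a ha] using ha
  have h1 : a ≤ a + η a a * τ := by
    refine le_add_of_nonneg_right (mul_nonneg ?_ hτ)
    rw [← hη.zero a ha]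
    exact hη.mono a ha
  obtain ⟨s, hs, hse⟩ := intermediate_value_Icc ha hc.continuousOn ⟨h0, h1⟩
  exact ⟨s, hs.1, hs.2, hse⟩

open Classical in
/-- The level `s` that is reached from the level `a` in time `τ` at the rate `η a s`. -/
noncomputable def decayLevel (η : ℝ → ℝ → ℝ) (a τ : ℝ) : ℝ :=
  if h : ∃ s, 0 ≤ s ∧ s ≤ a ∧ s + η a s * τ = a then h.choose else 0

variable {η : ℝ → ℝ → ℝ} {a b s τ : ℝ}

theorem IsDecayRate.decayLevel_spec (hη : IsDecayRate η) (ha : 0 ≤ a) (hτ : 0 ≤ τ) :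
    0 ≤ decayLevel η a τ ∧ decayLevel η a τ ≤ a ∧
      decayLevel η a τ + η a (decayLevel η a τ) * τ = a := by
  rw [decayLevel, dif_pos (hη.exists_level ha hτ)]
  exact (hη.exists_level ha hτ).choose_spec

theorem IsDecayRate.lt_decayLevel_iff (hη : IsDecayRate η) (ha : 0 ≤ a) (hτ : 0 ≤ τ) :
    s < decayLevel η a τ ↔ s + η a s * τ < a := by
  have h := (hη.strictMono a hτ).lt_iff_lt (a := s) (b := decayLevel η a τ)
  rw [(hη.decayLevel_spec ha hτ).2.2] at h
  exact h.symm

theorem IsDecayRate.decayLevel_lt_iff (hη : IsDecayRate η) (ha : 0 ≤ a) (hτ : 0 ≤ τ) :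
    decayLevel η a τ < s ↔ a < s + η a s * τ := by
  have h := (hη.strictMono a hτ).lt_iff_lt (a := decayLevel η a τ) (b := s)
  rw [(hη.decayLevel_spec ha hτ).2.2] at h
  exact h.symm

theorem IsDecayRate.decayLevel_zero (hη : IsDecayRate η) (hτ : 0 ≤ τ) : decayLevel η 0 τ = 0 :=
  le_antisymm (hη.decayLevel_spec le_rfl hτ).2.1 (hη.decayLevel_spec le_rfl hτ).1

theorem IsDecayRate.decayLevel_lt_decayLevel (hη : IsDecayRate η) (ha : 0 ≤ a) (hab : a < b)
    (hτ : 0 ≤ τ) : decayLevel η a τ < decayLevel η b τ := by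
  rw [hη.lt_decayLevel_iff (ha.trans hab.le) hτ]
  refine lt_of_le_of_lt ?_ hab
  conv_rhs => rw [← (hη.decayLevel_spec ha hτ).2.2]
  gcongr
  exact hη.anti _ hab.le

theorem IsDecayRate.antitoneOn_decayLevel (hη : IsDecayRate η) (ha : 0 ≤ a) :
    AntitoneOn (decayLevel η a) (Ici 0) := by
  intro τ hτ τ' hτ' hle
  by_contra! hlt
  rw [hη.lt_decayLevel_iff ha hτ'] at hlt
  have h := hη.decayLevel_spec ha hτ
  have h1 : 0 ≤ η a (decayLevel η a τ) := by
    rw [← hη.zero a ha]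
    exact hη.mono a h.1
  have h2 := mul_le_mul_of_nonneg_left hle h1
  linarith [h.2.2]

theorem IsDecayRate.tendsto_decayLevel (hη : IsDecayRate η) (ha : 0 ≤ a) :
    Tendsto (decayLevel η a) atTop (𝓝 0) := by
  refine tendsto_order.2 ⟨fun l hl => ?_, fun u hu => ?_⟩
  · filter_upwards [eventually_ge_atTop 0] with τ hτ
    exact hl.trans_le (hη.decayLevel_spec ha hτ).1
  · have h1 : Tendsto (fun τ => u + η a u * τ) atTop atTop :=
      tendsto_atTop_add_const_left _ _ (tendsto_id.const_mul_atTop (hη.pos a u hu))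
    filter_upwards [eventually_ge_atTop 0, h1.eventually_gt_atTop a] with τ hτ h
    exact (hη.decayLevel_lt_iff ha hτ).2 h

theorem IsDecayRate.continuousOn_decayLevel (hη : IsDecayRate η) :
    ContinuousOn (Function.uncurry (decayLevel η)) (Ici 0 ×ˢ Ici 0) := by
  rintro ⟨a, τ⟩ ⟨ha, hτ⟩
  have hc : ∀ s, Continuous fun q : ℝ × ℝ => s + η q.1 s * q.2 := fun s =>
    continuous_const.add ((hη.continuous.comp (continuous_fst.prodMk continuous_const)).mul
      continuous_snd)
  refine tendsto_order.2 ⟨fun l hl => ?_, fun u hu => ?_⟩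
  · have h1 := (hη.lt_decayLevel_iff ha hτ).1 hl
    filter_upwards [self_mem_nhdsWithin, mem_nhdsWithin_of_mem_nhds
      ((isOpen_lt (hc l) continuous_fst).mem_nhds h1)] with q hq h
    exact (hη.lt_decayLevel_iff hq.1 hq.2).2 h
  · have h1 := (hη.decayLevel_lt_iff ha hτ).1 hu
    filter_upwards [self_mem_nhdsWithin, mem_nhdsWithin_of_mem_nhds
      ((isOpen_lt continuous_fst (hc u)).mem_nhds h1)] with q hq h
    exact (hη.decayLevel_lt_iff hq.1 hq.2).2 h

theorem antitoneOn_Ico_of_hasDerivWithinAt_nonpos {t₀ T : ℝ} {v v' : ℝ → ℝ}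
    (hv : ∀ t ∈ Ico t₀ T, HasDerivWithinAt v (v' t) (Ico t₀ T) t) (hv' : ∀ t ∈ Ico t₀ T, v' t ≤ 0) :
    AntitoneOn v (Ico t₀ T) :=
  antitoneOn_of_hasDerivWithinAt_nonpos (convex_Ico t₀ T)
    (fun t ht => (hv t ht).continuousWithinAt)
    (fun t ht => (hv t (interior_subset ht)).mono interior_subset)
    fun t ht => hv' t (interior_subset ht)

/-- A differentiable function that decreases at rate at least `η a s` while above the level `s`
is bounded by the implicit decay level. -/
theorem IsDecayRate.le_decayLevel (hη : IsDecayRate η) {t₀ T : ℝ} {v v' : ℝ → ℝ} (ha : 0 ≤ a)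
    (hv : ∀ t ∈ Ico t₀ T, HasDerivWithinAt v (v' t) (Ico t₀ T) t)
    (hv' : ∀ t ∈ Ico t₀ T, v' t ≤ 0) (h0 : v t₀ ≤ a)
    (hdec : ∀ t ∈ Ico t₀ T, ∀ s, s ≤ v t → v' t ≤ -η a s) {t : ℝ} (ht : t ∈ Ico t₀ T) :
    v t ≤ decayLevel η a (t - t₀) := by
  have hanti := antitoneOn_Ico_of_hasDerivWithinAt_nonpos hv hv'
  have hτ : 0 ≤ t - t₀ := sub_nonneg.2 ht.1
  obtain ⟨-, -, hs⟩ := hη.decayLevel_spec ha hτ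
  set s := decayLevel η a (t - t₀)
  by_contra! hlt
  have hsub : Icc t₀ t ⊆ Ico t₀ T := fun r hr => ⟨hr.1, hr.2.trans_lt ht.2⟩
  have hw : ∀ r ∈ Icc t₀ t,
      HasDerivWithinAt (fun r => v r + η a s * r) (v' r + η a s) (Icc t₀ t) r := fun r hr => by
    simpa using ((hv r (hsub hr)).mono hsub).fun_add
      (((hasDerivAt_id r).const_mul (η a s)).hasDerivWithinAt)
  have hwanti := antitoneOn_of_hasDerivWithinAt_nonpos (convex_Icc t₀ t)
    (fun r hr => (hw r hr).continuousWithinAt)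
    (fun r hr => (hw r (interior_subset hr)).mono interior_subset) fun r hr => by
      have hr' := interior_subset hr
      have := hdec r (hsub hr') s (hlt.le.trans (hanti (hsub hr') ht hr'.2))
      linarith
  have h1 := hwanti (left_mem_Icc.2 ht.1) (right_mem_Icc.2 ht.1) ht.1
  simp only at h1
  rw [mul_sub] at hs
  linarith

end ImplicitDecay

section Comparison

variable {X : Type*} [MetricSpace X] {B : Set X} {xs : X} {W₁ W₂ W₃ : X → ℝ}

theorem IsContPosDefOn.nonneg (h : IsContPosDefOn W₁ xs B) {x : X} (hx : x ∈ B) : 0 ≤ W₁ x := by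
  rcases eq_or_ne x xs with rfl | hne
  · exact h.2.1.ge
  · exact (h.2.2 x hx hne).le

theorem IsContPosDefOn.eq_of_eq_zero (h : IsContPosDefOn W₁ xs B) {x : X} (hx : x ∈ B)
    (h0 : W₁ x = 0) : x = xs := by
  by_contra hne
  exact (h.2.2 x hx hne).ne' h0

theorem IsContPosDefOn.mono {B' : Set X} (h : IsContPosDefOn W₁ xs B) (hB : B' ⊆ B) :
    IsContPosDefOn W₁ xs B' :=
  ⟨h.1.mono hB, h.2.1, fun y hy => h.2.2 y (hB hy)⟩

/-- The smallest decay `W₃` guarantees at points where `s ≤ W₂` and `W₁ ≤ a`, relaxed so as to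
depend continuously on `a` and `s`. -/
noncomputable def infDecay (B : Set X) (W₁ W₂ W₃ : X → ℝ) (a s : ℝ) : ℝ :=
  ⨅ x : B, (W₃ x + max (s - W₂ x) 0 + max (W₁ x - a) 0)

theorem infDecay_bddBelow (h₃ : IsContPosDefOn W₃ xs B) (a s : ℝ) :
    BddBelow (range fun x : B => W₃ x + max (s - W₂ x) 0 + max (W₁ x - a) 0) :=
  ⟨0, by
    rintro _ ⟨x, rfl⟩
    exact add_nonneg (add_nonneg (h₃.nonneg x.2) (le_max_right _ _)) (le_max_right _ _)⟩

theorem infDecay_le (h₃ : IsContPosDefOn W₃ xs B) {a s : ℝ} {x : X} (hx : x ∈ B) (hs : s ≤ W₂ x)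
    (ha : W₁ x ≤ a) : infDecay B W₁ W₂ W₃ a s ≤ W₃ x := by
  refine (ciInf_le (infDecay_bddBelow h₃ a s) ⟨x, hx⟩).trans ?_
  simp [max_eq_right (sub_nonpos.2 hs), max_eq_right (sub_nonpos.2 ha)]

theorem isDecayRate_infDecay (hxs : xs ∈ B) (h₁ : IsContPosDefOn W₁ xs B)
    (h₂ : IsContPosDefOn W₂ xs B) (h₃ : IsContPosDefOn W₃ xs B)
    (hK : ∀ c : ℝ, ∃ K ⊆ B, IsCompact K ∧ ∀ x ∈ B, W₁ x ≤ c → x ∈ K) :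
    IsDecayRate (infDecay B W₁ W₂ W₃) := by
  have : Nonempty B := ⟨⟨xs, hxs⟩⟩
  have h0 : ∀ (x : B) (q : ℝ × ℝ), 0 ≤ W₃ x + max (q.2 - W₂ x) 0 + max (W₁ x - q.1) 0 :=
    fun x q => add_nonneg (add_nonneg (h₃.nonneg x.2) (le_max_right _ _)) (le_max_right _ _)
  refine ⟨?_, fun a s s' hs => ?_, fun s a a' ha => ?_, fun a ha => ?_, fun a s hs => ?_⟩
  · have hL : ∀ c : ℝ, LipschitzWith 1 fun a : ℝ => max (c - a) 0 := fun c => by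
      refine LipschitzWith.of_le_add fun s t => ?_
      rw [Real.dist_eq]
      refine max_le ?_ (add_nonneg (le_max_right _ _) (abs_nonneg _))
      linarith [le_max_left (c - t) 0, neg_abs_le (s - t)]
    refine (lipschitzWith_iInf (C := 2)
      (F := fun (x : B) (q : ℝ × ℝ) => W₃ x + max (q.2 - W₂ x) 0 + max (W₁ x - q.1) 0)
      (fun x => ?_) h0).continuous
    have := (((LipschitzWith.const (W₃ x)).add
      ((lipschitzWith_max_sub_zero (W₂ x)).comp LipschitzWith.prod_snd)).add
      ((hL (W₁ x)).comp (LipschitzWith.prod_fst (α := ℝ) (β := ℝ))))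
    refine (this.weaken ?_)
    norm_num
  · exact ciInf_mono (infDecay_bddBelow h₃ a s) fun x => by gcongr
  · exact ciInf_mono (infDecay_bddBelow h₃ a' s) fun x => by gcongr
  · refine le_antisymm ?_ (le_ciInf fun x => h0 x (a, 0))
    have := infDecay_le (W₁ := W₁) (W₂ := W₂) h₃ (a := a) (s := 0) hxs h₂.2.1.ge (h₁.2.1.trans_le ha)
    rwa [h₃.2.1] at this
  · obtain ⟨K, hKB, hKc, hKW⟩ := hK (a + 1)
    refine iInf_pos_of_compact_core (F := fun x => W₃ x + max (s - W₂ x) 0 + max (W₁ x - a) 0)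
      ⟨xs, hxs⟩ ((h₃.1.add ((continuousOn_const.sub h₂.1).sup continuousOn_const)).add
        ((h₁.1.sub continuousOn_const).sup continuousOn_const)) (fun x hx => ?_) hKB hKc
      fun x hx hxK => ?_
    · refine add_pos_of_pos_of_nonneg ?_ (le_max_right _ _)
      rcases eq_or_ne x xs with rfl | hne
      · simpa [h₃.2.1, h₂.2.1] using hs
      · exact add_pos_of_pos_of_nonneg (h₃.2.2 x hx hne) (le_max_right _ _)
    · have h : a + 1 < W₁ x := by
        by_contra hle
        exact hxK (hKW x hx (not_lt.1 hle))
      refine le_add_of_nonneg_of_le (add_nonneg (h₃.nonneg hx) (le_max_right _ _)) ?_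
      exact le_max_of_le_left (by linarith)

/-- The comparison principle: a curve along which a Lyapunov function decays obeys a class `KL`
bound that depends only on the bounding functions. -/
theorem exists_isClassKL_bound (hxs : xs ∈ B) (h₁ : IsContPosDefOn W₁ xs B)
    (h₂ : IsContPosDefOn W₂ xs B) (h₃ : IsContPosDefOn W₃ xs B)
    (hK : ∀ c : ℝ, ∃ K ⊆ B, IsCompact K ∧ ∀ x ∈ B, W₁ x ≤ c → x ∈ K)
    {a : ℝ≥0∞} {θ : ℝ → ℝ} (hθ : IsClassK a θ)
    (hBa : ∀ x ∈ B, dist x xs ∈ halfOpenFromZero a)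
    (hθK : ∀ c : ℝ, ∃ K ⊆ B, IsCompact K ∧ ∀ x ∈ B, θ (dist x xs) ≤ c → x ∈ K) :
    ∃ β, IsClassKL a β ∧ ∀ (t₀ T : ℝ) (x : ℝ → X) (v v' : ℝ → ℝ),
      (∀ t ∈ Ico t₀ T, x t ∈ B ∧ W₁ (x t) ≤ v t ∧ v t ≤ W₂ (x t) ∧
        HasDerivWithinAt v (v' t) (Ico t₀ T) t ∧ v' t ≤ -W₃ (x t)) →
      ∀ t ∈ Ico t₀ T, dist xs (x t) ≤ β (dist xs (x t₀)) (t - t₀) := by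
  have hdist : ContinuousOn (fun x => dist x xs) B := (continuous_id.dist continuous_const).continuousOn
  have hη := isDecayRate_infDecay hxs h₁ h₂ h₃ hK
  have h0a : (0 : ℝ) ∈ halfOpenFromZero a := by simpa using hBa xs hxs
  have hθ0 : ∀ s ∈ halfOpenFromZero a, 0 ≤ θ s := fun s hs => by
    rw [← hθ.2.2]
    exact hθ.2.1.monotoneOn h0a hs hs.1
  obtain ⟨e₁, he₁0, he₁⟩ := exists_orderIso_comp_le hdist h₁.1 (fun x _ => dist_nonneg)
    (fun x hx => h₁.nonneg hx) (fun x hx h => by rw [h₁.eq_of_eq_zero hx h, dist_self]) hxs hK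
  obtain ⟨e₂, he₂0, he₂⟩ := exists_orderIso_comp_le (q := fun x => θ (dist x xs)) h₂.1
    (hθ.1.comp hdist hBa) (fun x hx => h₂.nonneg hx) (fun x hx => hθ0 _ (hBa x hx))
    (fun x hx h => by
      have h' : dist x xs = 0 := hθ.2.1.injOn (hBa x hx) h0a (h.trans hθ.2.2.symm)
      rw [dist_eq_zero.1 h', h₂.2.1]) hxs hθK
  have he₁s : e₁.symm 0 = 0 := by rw [← he₁0, e₁.symm_apply_apply, he₁0]
  have he₂s : e₂.symm 0 = 0 := by rw [← he₂0, e₂.symm_apply_apply, he₂0]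
  set η := infDecay B W₁ W₂ W₃ with hηdef
  let α : ℝ → ℝ := fun ρ => e₂.symm (θ ρ)
  have hα0 : ∀ ρ ∈ halfOpenFromZero a, 0 ≤ α ρ := fun ρ hρ => by
    rw [← he₂s]
    exact e₂.symm.monotone (hθ0 ρ hρ)
  have hαc : ContinuousOn α (halfOpenFromZero a) := e₂.symm.continuous.comp_continuousOn hθ.1
  have hβc : ContinuousOn (Function.uncurry fun ρ τ => e₁.symm (decayLevel η (α ρ) τ))
      (halfOpenFromZero a ×ˢ Ici 0) := by
    refine e₁.symm.continuous.comp_continuousOn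
      (hη.continuousOn_decayLevel.comp (f := fun q : ℝ × ℝ => (α q.1, q.2)) ?_ ?_)
    · exact (hαc.comp continuousOn_fst fun q hq => hq.1).prodMk continuousOn_snd
    · exact fun q hq => ⟨hα0 _ hq.1, hq.2⟩
  refine ⟨fun ρ τ => e₁.symm (decayLevel η (α ρ) τ), ⟨hβc, fun τ hτ => ⟨?_, ?_, ?_⟩,
    fun ρ hρ => ⟨fun τ hτ τ' hτ' hle => ?_, ?_⟩⟩, ?_⟩
  · exact hβc.comp (f := fun ρ => (ρ, τ)) (by fun_prop) fun ρ hρ => ⟨hρ, hτ⟩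
  · exact fun ρ hρ ρ' hρ' hlt => e₁.symm.strictMono (hη.decayLevel_lt_decayLevel (hα0 ρ hρ)
      (e₂.symm.strictMono (hθ.2.1 hρ hρ' hlt)) hτ)
  · simp only [α, hθ.2.2, he₂s, hη.decayLevel_zero hτ, he₁s]
  · exact e₁.symm.monotone (hη.antitoneOn_decayLevel (hα0 ρ hρ) hτ hτ' hle)
  · have := (e₁.symm.continuous.tendsto 0).comp (hη.tendsto_decayLevel (hα0 ρ hρ))
    rwa [he₁s] at this
  · intro t₀ T x v v' h t ht
    have ht₀ : t₀ ∈ Ico t₀ T := ⟨le_rfl, ht.1.trans_lt ht.2⟩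
    have hv' : ∀ r ∈ Ico t₀ T, v' r ≤ 0 := fun r hr => by
      linarith [(h r hr).2.2.2.2, h₃.nonneg (h r hr).1]
    have hanti := antitoneOn_Ico_of_hasDerivWithinAt_nonpos (fun r hr => (h r hr).2.2.2.1) hv'
    have hρ := hBa _ (h t₀ ht₀).1
    have hstart : v t₀ ≤ α (dist (x t₀) xs) :=
      (h t₀ ht₀).2.2.1.trans ((e₂.le_symm_apply).2 (he₂ _ (h t₀ ht₀).1))
    have hle := hη.le_decayLevel (hα0 _ hρ) (fun r hr => (h r hr).2.2.2.1) hv' hstart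
      (fun r hr s hs => (h r hr).2.2.2.2.trans (neg_le_neg (infDecay_le h₃ (h r hr).1
        (hs.trans (h r hr).2.2.1)
        ((h r hr).2.1.trans ((hanti ht₀ hr hr.1).trans hstart))))) ht
    rw [dist_comm xs, dist_comm xs, e₁.le_symm_apply]
    exact (he₁ _ (h t ht).1).trans ((h t ht).2.1.trans hle)

end Comparison

section LyapunovChainRule

variable {n : ℕ} {M : Type*} [MetricSpace M] [ChartedSpace (EuclideanSpace ℝ (Fin n)) M]
  {f : ℝ → (x : M) → TangentSpace (𝓡 n) x} {D : Set M} {V : ℝ → M → ℝ} {W₁ W₂ W₃ : M → ℝ}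

/-- The derivative of a Lyapunov function along a solution is the sum of its partial
derivatives. -/
theorem IsLyapunov.hasDerivWithinAt_comp (hV : IsLyapunov f D V W₁ W₂ W₃) (hD : IsOpen D)
    {x : ℝ → M} {J : Set ℝ} (hJ : J ⊆ Ici 0) (hx : IsSolutionOn f D x J) {t : ℝ} (ht : t ∈ J) :
    HasDerivWithinAt (fun s => V s (x s))
      (derivWithin (fun s => V s (x t)) (Ici 0) t
        + mvfderiv (𝓡 n) (V t) (x t) (f t (x t))) J t := by
  obtain ⟨hxD, hxd⟩ := hx t ht
  have ht0 : t ∈ Ici (0 : ℝ) := hJ ht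
  have hF := (hV.contMDiffOn.mdifferentiableOn one_ne_zero (t, x t) ⟨ht0, hxD⟩).hasMFDerivWithinAt
  let F : ℝ × M → ℝ := fun q => V q.1 q.2
  let L : ℝ × EuclideanSpace ℝ (Fin n) →L[ℝ] ℝ :=
    mfderivWithin (𝓘(ℝ, ℝ).prod (𝓡 n)) 𝓘(ℝ, ℝ) (fun q : ℝ × M => V q.1 q.2) (Ici 0 ×ˢ D) (t, x t)
  have hm1 : MapsTo (fun s => (s, x s)) J (Ici (0 : ℝ) ×ˢ D) := fun s hs => ⟨hJ hs, (hx s hs).1⟩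
  have hm2 : MapsTo (fun s => (s, x t)) (Ici 0) (Ici (0 : ℝ) ×ˢ D) := fun s hs => ⟨hs, hxD⟩
  have hm3 : MapsTo (fun y => (t, y)) D (Ici (0 : ℝ) ×ˢ D) := fun y hy => ⟨ht0, hy⟩
  have h1 : HasFDerivWithinAt (fun s => V s (x s))
      (L ∘L (ContinuousLinearMap.id ℝ ℝ).prod ((1 : ℝ →L[ℝ] ℝ).smulRight (f t (x t)))) J t :=
    (HasMFDerivWithinAt.comp (f := fun s => (s, x s)) (g := F) t hF
      ((hasMFDerivWithinAt_id J t).prodMk hxd) hm1).hasFDerivWithinAt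
  have h2 : HasFDerivWithinAt (fun s => V s (x t))
      (L ∘L (ContinuousLinearMap.id ℝ ℝ).prod 0) (Ici 0) t :=
    (HasMFDerivWithinAt.comp (f := fun s => (s, x t)) (g := F) t hF
      ((hasMFDerivWithinAt_id (I := 𝓘(ℝ, ℝ)) (Ici 0) t).prodMk
        (hasMFDerivWithinAt_const (I' := 𝓡 n) (x t) (Ici 0) t)) hm2).hasFDerivWithinAt
  have h3 : HasMFDerivAt (𝓡 n) 𝓘(ℝ, ℝ) (V t) (x t)
      (L ∘L ContinuousLinearMap.prod 0 (ContinuousLinearMap.id ℝ (EuclideanSpace ℝ (Fin n)))) :=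
    (hF.comp (x t) ((hasMFDerivWithinAt_const t D (x t)).prodMk
      (hasMFDerivWithinAt_id D (x t))) hm3).hasMFDerivAt (hD.mem_nhds hxD)
  have e2 : derivWithin (fun s => V s (x t)) (Ici 0) t = L (1, 0) := by
    rw [h2.hasDerivWithinAt.derivWithin (uniqueDiffOn_Ici 0 t ht0)]
    rfl
  have e3 : mvfderiv (𝓡 n) (V t) (x t) (f t (x t)) = L (0, f t (x t)) := by
    change mfderiv (𝓡 n) 𝓘(ℝ, ℝ) (V t) (x t) (f t (x t)) = _
    rw [h3.mfderiv]
    rfl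
  have e1 : (L ∘L (ContinuousLinearMap.id ℝ ℝ).prod ((1 : ℝ →L[ℝ] ℝ).smulRight (f t (x t)))) 1
      = L (1, 0) + L (0, f t (x t)) := by
    have hL : ∀ w : EuclideanSpace ℝ (Fin n), L (1, (1 : ℝ) • w) = L (1, 0) + L (0, w) := fun w => by
      rw [one_smul, ← map_add, Prod.mk_add_mk, add_zero, zero_add]
    exact hL (f t (x t))
  rw [e2, e3, ← e1]
  exact h1.hasDerivWithinAt

end LyapunovChainRule

section Balls

variable {X : Type*} [MetricSpace X] {x : X} {D : Set X}

theorem closedBall_subset_of_lt_inradiusAt {r : ℝ} (hr : ENNReal.ofReal r < inradiusAt x D) :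
    Metric.closedBall x r ⊆ D := by
  simp only [inradiusAt, lt_iSup_iff] at hr
  obtain ⟨R, ⟨hR, hRD⟩, hlt⟩ := hr
  exact (Metric.closedBall_subset_ball ((ENNReal.ofReal_lt_ofReal_iff hR).1 hlt)).trans hRD

theorem eball_inradiusAt_subset : Metric.eball x (inradiusAt x D) ⊆ D := fun y hy => by
  rw [Metric.mem_eball, edist_dist] at hy
  exact closedBall_subset_of_lt_inradiusAt hy (Metric.mem_closedBall.2 le_rfl)

theorem inradiusAt_pos (hD : IsOpen D) (hx : x ∈ D) : 0 < inradiusAt x D := by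
  obtain ⟨r, hr, hrD⟩ := Metric.isOpen_iff.1 hD x hx
  exact (ENNReal.ofReal_pos.2 hr).trans_le (le_iSup₂_of_le r ⟨hr, hrD⟩ le_rfl)

theorem closedBall_subset_eball {r : ℝ} {R : ℝ≥0∞} (hr : ENNReal.ofReal r < R) :
    Metric.closedBall x r ⊆ Metric.eball x R := fun y hy => by
  rw [Metric.mem_eball, edist_dist]
  exact (ENNReal.ofReal_le_ofReal hy).trans_lt hr

theorem mem_eball_iff_dist_mem_halfOpenFromZero {R : ℝ≥0∞} {y : X} :
    y ∈ Metric.eball x R ↔ dist y x ∈ halfOpenFromZero R := by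
  rw [Metric.mem_eball, edist_dist]
  exact ⟨fun h => ⟨dist_nonneg, h⟩, fun h => h.2⟩

/-- The sublevel sets of a function that tends to infinity at the boundary of a ball are contained
in smaller balls. -/
theorem exists_dist_le_of_tendsto_nearBoundary {R : ℝ≥0∞} (hR : 0 < R) {G : X → ℝ}
    (hG : Tendsto G (nearBoundary x R) atTop) (c : ℝ) :
    ∃ r : ℝ, 0 ≤ r ∧ ENNReal.ofReal r < R ∧ ∀ y ∈ Metric.eball x R, G y ≤ c → dist y x ≤ r := by
  have h := hG.eventually_gt_atTop c
  rw [nearBoundary, eventually_inf_principal, eventually_comap] at h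
  obtain ⟨l, hl, hlR⟩ := exists_Ioc_subset_of_mem_nhds h ⟨0, hR⟩
  have hl' : l ≠ ⊤ := hl.ne_top
  refine ⟨l.toReal, ENNReal.toReal_nonneg, by rwa [ENNReal.ofReal_toReal hl'], fun y hy hyc => ?_⟩
  rw [dist_edist]
  refine ENNReal.toReal_mono hl' ?_
  by_contra! hlt
  exact hyc.not_gt (hlR ⟨hlt, (Metric.mem_eball.1 hy).le⟩ y rfl hy)

theorem ofReal_lt_iff_toReal_inv_mul_lt_one {R : ℝ≥0∞} (hR : 0 < R) (s : ℝ) :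
    ENNReal.ofReal s < R ↔ (R⁻¹).toReal * s < 1 := by
  rcases eq_or_ne R ⊤ with rfl | hfin
  · simp
  · rw [ENNReal.toReal_inv, inv_mul_lt_iff₀ (ENNReal.toReal_pos hR.ne' hfin), mul_one]
    conv_lhs => rw [← ENNReal.ofReal_toReal hfin]
    exact ENNReal.ofReal_lt_ofReal_iff (ENNReal.toReal_pos hR.ne' hfin)

/-- A class `K` function on `[0, R)` that is unbounded at `R`. -/
theorem exists_isClassK_unbounded {R : ℝ≥0∞} (hR : 0 < R) :
    ∃ θ, IsClassK R θ ∧ ∀ c : ℝ, ∃ r : ℝ, ENNReal.ofReal r < R ∧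
      ∀ s ∈ halfOpenFromZero R, θ s ≤ c → s ≤ r := by
  set κ := (R⁻¹).toReal
  have hκ : 0 ≤ κ := ENNReal.toReal_nonneg
  have hpos : ∀ s ∈ halfOpenFromZero R, 0 < 1 - κ * s := fun s hs =>
    sub_pos.2 ((ofReal_lt_iff_toReal_inv_mul_lt_one hR s).1 hs.2)
  refine ⟨fun s => s / (1 - κ * s), ⟨?_, fun s hs t ht hst => ?_, by simp⟩, fun c => ?_⟩
  · exact continuousOn_id.div (by fun_prop) fun s hs => (hpos s hs).ne'
  · simp only
    rw [div_lt_div_iff₀ (hpos s hs) (hpos t ht)]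
    nlinarith
  · have hc : 0 < 1 + κ * max c 0 := by positivity
    refine ⟨max c 0 / (1 + κ * max c 0), ?_, fun s hs hle => ?_⟩
    · rw [ofReal_lt_iff_toReal_inv_mul_lt_one hR, ← mul_div_assoc, div_lt_one hc]
      exact lt_one_add _
    · rw [le_div_iff₀ hc]
      have h1 := (div_le_iff₀ (hpos s hs)).1 (hle.trans (le_max_left c 0))
      linarith

end Balls

theorem ContinuousOn.lt_of_forall_ne {ρ : ℝ → ℝ} {t₀ T R : ℝ} (hρ : ContinuousOn ρ (Ico t₀ T))
    (h0 : ρ t₀ < R) (hne : ∀ t ∈ Ico t₀ T, ρ t ≠ R) {t : ℝ} (ht : t ∈ Ico t₀ T) : ρ t < R := by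
  by_contra! hle
  have hsub : Icc t₀ t ⊆ Ico t₀ T := fun s hs => ⟨hs.1, hs.2.trans_lt ht.2⟩
  obtain ⟨s, hs, hse⟩ := intermediate_value_Icc ht.1 (hρ.mono hsub) ⟨h0.le, hle⟩
  exact hne s (hsub hs) hse

/-- A function that decreases as long as it is below a level stays below its initial value. -/
theorem le_of_hasDerivWithinAt_nonpos_of_lt {h h' : ℝ → ℝ} {t₀ T A : ℝ}
    (hd : ∀ t ∈ Ico t₀ T, HasDerivWithinAt h (h' t) (Ico t₀ T) t)
    (hneg : ∀ t ∈ Ico t₀ T, h t < A → h' t ≤ 0) (h0 : h t₀ < A) {t : ℝ} (ht : t ∈ Ico t₀ T) :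
    h t ≤ h t₀ := by
  by_contra! hlt
  have hsub : Icc t₀ t ⊆ Ico t₀ T := fun s hs => ⟨hs.1, hs.2.trans_lt ht.2⟩
  have hm : 0 < min (h t) A - h t₀ := sub_pos.2 (lt_min hlt h0)
  have hd0 : 0 < t - t₀ + 1 := by linarith [ht.1]
  set ε := (min (h t) A - h t₀) / (t - t₀ + 1) with hε
  have hεpos : 0 < ε := div_pos hm hd0
  have hεt : h t₀ + ε * (t - t₀) < min (h t) A := by
    have : ε * (t - t₀ + 1) = min (h t) A - h t₀ := div_mul_cancel₀ _ hd0.ne'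
    linarith
  have hB : ∀ s, HasDerivAt (fun s => h t₀ + ε * (s - t₀)) ε s := fun s => by
    simpa using (((hasDerivAt_id s).sub_const t₀).const_mul ε).const_add (h t₀)
  have key := image_le_of_deriv_right_lt_deriv_boundary' (f := h) (f' := h') (a := t₀) (b := t)
    (B := fun s => h t₀ + ε * (s - t₀)) (B' := fun _ => ε)
    (fun s hs => ((hd s (hsub hs)).mono hsub).continuousWithinAt)
    (fun s hs => (hd s (hsub (Ico_subset_Icc_self hs))).mono_of_mem_nhdsWithin
      (mem_of_superset (Ico_mem_nhdsGE (hs.2.trans ht.2)) (Ico_subset_Ico_left hs.1)))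
    (by simp) (fun s _ => (hB s).continuousAt.continuousWithinAt)
    (fun s _ => (hB s).hasDerivWithinAt)
    (fun s hs hse => (hneg s (hsub (Ico_subset_Icc_self hs)) (by
      rw [hse]
      have h1 := mul_le_mul_of_nonneg_left (sub_le_sub_right hs.2.le t₀) hεpos.le
      linarith [min_le_right (h t) A])).trans_lt hεpos)
    (right_mem_Icc.2 ht.1)
  linarith [min_le_left (h t) A]

section Main

variable {n : ℕ} {M : Type*} [MetricSpace M] [ChartedSpace (EuclideanSpace ℝ (Fin n)) M]
  {f : ℝ → (x : M) → TangentSpace (𝓡 n) x} {D : Set M} {xs : M} {V : ℝ → M → ℝ}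
  {W₁ W₂ W₃ : M → ℝ}

/-- A Lyapunov function does not increase along solutions. -/
theorem IsLyapunov.lower_le (hV : IsLyapunov f D V W₁ W₂ W₃) (hD : IsOpen D)
    (hW₃ : IsContPosDefOn W₃ xs D) {t₀ T : ℝ} (ht₀ : 0 ≤ t₀) {x : ℝ → M}
    (hx : IsSolutionOn f D x (Ico t₀ T)) {t : ℝ} (ht : t ∈ Ico t₀ T) :
    W₁ (x t) ≤ V t₀ (x t₀) := by
  have hJ : Ico t₀ T ⊆ Ici 0 := fun s hs => ht₀.trans hs.1
  have hanti := antitoneOn_Ico_of_hasDerivWithinAt_nonpos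
    (fun s hs => hV.hasDerivWithinAt_comp hD hJ hx hs) fun s hs =>
      (hV.decay s (hJ hs) _ (hx s hs).1).trans (neg_nonpos.2 (hW₃.nonneg (hx s hs).1))
  exact (hV.lower t (hJ ht) _ (hx t ht).1).trans (hanti ⟨le_rfl, ht.1.trans_lt ht.2⟩ ht ht.1)

/-- If solutions remain in compact subsets of `B`, and decay there in the sense of the comparison
principle, then they exist for all times and obey a class `KL` bound. -/
theorem IsContLocLipschitz.exists_hasKLBoundFrom [IsManifold (𝓡 n) ∞ M]
    (hf : IsContLocLipschitz f D) {B S : Set M}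
    (hBD : B ⊆ D) (hxs : xs ∈ B) (h₁ : IsContPosDefOn W₁ xs B) (h₂ : IsContPosDefOn W₂ xs B)
    (h₃ : IsContPosDefOn W₃ xs B)
    (hK : ∀ c : ℝ, ∃ K ⊆ B, IsCompact K ∧ ∀ x ∈ B, W₁ x ≤ c → x ∈ K)
    {a : ℝ≥0∞} {θ : ℝ → ℝ} (hθ : IsClassK a θ) (hBa : ∀ x ∈ B, dist x xs ∈ halfOpenFromZero a)
    (hθK : ∀ c : ℝ, ∃ K ⊆ B, IsCompact K ∧ ∀ x ∈ B, θ (dist x xs) ≤ c → x ∈ K)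
    (hinv : ∀ t₀, 0 ≤ t₀ → ∀ x₀ ∈ S, ∃ K ⊆ B, IsCompact K ∧ x₀ ∈ K ∧
      ∀ (T : ℝ) (x : ℝ → M), IsSolutionOn f D x (Ico t₀ T) → x t₀ = x₀ →
        ∀ t ∈ Ico t₀ T, x t ∈ K)
    (hdec : ∀ t₀, 0 ≤ t₀ → ∀ (T : ℝ) (x : ℝ → M), IsSolutionOn f D x (Ico t₀ T) →
      (∀ t ∈ Ico t₀ T, x t ∈ B) → ∃ v v' : ℝ → ℝ, ∀ t ∈ Ico t₀ T, W₁ (x t) ≤ v t ∧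
        v t ≤ W₂ (x t) ∧ HasDerivWithinAt v (v' t) (Ico t₀ T) t ∧ v' t ≤ -W₃ (x t)) :
    ∃ β, IsClassKL a β ∧ HasKLBoundFrom f D xs S β := by
  obtain ⟨β, hβ, hbound⟩ := exists_isClassKL_bound hxs h₁ h₂ h₃ hK hθ hBa hθK
  refine ⟨β, hβ, fun t₀ ht₀ x₀ hx₀ => ?_⟩
  obtain ⟨K, hKB, hKc, hx₀K, hKinv⟩ := hinv t₀ ht₀ x₀ hx₀
  refine ⟨hf.exists_global_solution hKc (hKB.trans hBD) ht₀ hx₀K hKinv, ?_⟩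
  rintro T x hx rfl t ht
  have hxB : ∀ t ∈ Ico t₀ T, x t ∈ B := fun t ht => hKB (hKinv T x hx rfl t ht)
  obtain ⟨v, v', hv⟩ := hdec t₀ ht₀ T x hx hxB
  exact hbound t₀ T x v v' (fun t ht => ⟨hxB t ht, hv t ht⟩) t ht

theorem IsLyapunov.exists_decay (hV : IsLyapunov f D V W₁ W₂ W₃) (hD : IsOpen D) {t₀ T : ℝ}
    (ht₀ : 0 ≤ t₀) {x : ℝ → M} (hx : IsSolutionOn f D x (Ico t₀ T)) :
    ∃ v v' : ℝ → ℝ, ∀ t ∈ Ico t₀ T, W₁ (x t) ≤ v t ∧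
        v t ≤ W₂ (x t) ∧ HasDerivWithinAt v (v' t) (Ico t₀ T) t ∧ v' t ≤ -W₃ (x t) := by
  have hJ : Ico t₀ T ⊆ Ici 0 := fun s hs => ht₀.trans hs.1
  exact ⟨_, _, fun t ht => ⟨hV.lower t (hJ ht) _ (hx t ht).1, hV.upper t (hJ ht) _ (hx t ht).1,
    hV.hasDerivWithinAt_comp hD hJ hx ht, hV.decay t (hJ ht) _ (hx t ht).1⟩⟩

/-- The quotient `V / (A - h)` decays if `V ≥ 0` does and `h < A` does not increase. -/
theorem exists_decay_div {t₀ T A : ℝ} {v v' h h' w₁ w₂ w₃ : ℝ → ℝ}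
    (hv : ∀ t ∈ Ico t₀ T, w₁ t ≤ v t ∧ v t ≤ w₂ t ∧ HasDerivWithinAt v (v' t) (Ico t₀ T) t ∧
      v' t ≤ -w₃ t)
    (hw : ∀ t ∈ Ico t₀ T, 0 ≤ w₁ t)
    (hh : ∀ t ∈ Ico t₀ T, HasDerivWithinAt h (h' t) (Ico t₀ T) t ∧ h' t ≤ 0 ∧ h t < A) :
    ∃ u u' : ℝ → ℝ, ∀ t ∈ Ico t₀ T, w₁ t / (A - h t) ≤ u t ∧ u t ≤ w₂ t / (A - h t) ∧
      HasDerivWithinAt u (u' t) (Ico t₀ T) t ∧ u' t ≤ -(w₃ t / (A - h t)) := by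
  refine ⟨fun t => v t / (A - h t),
    fun t => (v' t * (A - h t) - v t * (-h' t)) / (A - h t) ^ 2, fun t ht => ?_⟩
  obtain ⟨hlo, hup, hvd, hv'⟩ := hv t ht
  obtain ⟨hhd, hh', hlt⟩ := hh t ht
  have hpos : 0 < A - h t := sub_pos.2 hlt
  refine ⟨(div_le_div_iff_of_pos_right hpos).2 hlo, (div_le_div_iff_of_pos_right hpos).2 hup,
    hvd.div (hhd.const_sub A) hpos.ne', ?_⟩
  rw [← neg_div, div_le_div_iff₀ (by positivity) hpos]
  have h1 : v' t * (A - h t) - v t * (-h' t) ≤ -w₃ t * (A - h t) := by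
    have := mul_le_mul_of_nonneg_right hv' hpos.le
    nlinarith [(hw t ht).trans hlo]
  calc _ ≤ -w₃ t * (A - h t) * (A - h t) := mul_le_mul_of_nonneg_right h1 hpos.le
    _ = _ := by ring

end Main

theorem theorem2p1 {n : ℕ} (hn : 0 < n) {M : Type*} [MetricSpace M] [CompleteSpace M]
    [ChartedSpace (EuclideanSpace ℝ (Fin n)) M] [IsManifold (𝓡 n) ∞ M]
    [RiemannianBundle (fun x : M => TangentSpace (𝓡 n) x)]
    [IsContMDiffRiemannianBundle (𝓡 n) ∞ (EuclideanSpace ℝ (Fin n)) (fun x : M => TangentSpace (𝓡 n) x)]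
    [IsRiemannianManifold (𝓡 n) M]
    (D : Set M) (hD : IsOpen D) (xs : M) (hxs : xs ∈ D)
    (hDi : D ⊆ Metric.eball xs (injectivityRadius n xs))
    (f : ℝ → (x : M) → TangentSpace (𝓡 n) x) (hf : IsContLocLipschitz f D)
    (heq : ∀ t, 0 ≤ t → f t xs = 0)
    (V : ℝ → M → ℝ) (W₁ W₂ W₃ : M → ℝ)
    (hW₁ : IsContPosDefOn W₁ xs D) (hW₂ : IsContPosDefOn W₂ xs D)
    (hW₃ : IsContPosDefOn W₃ xs D) (hV : IsLyapunov f D V W₁ W₂ W₃)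
    (r₀ : ℝ≥0∞) (hr₀ : r₀ = inradiusAt xs D) :
    (∀ r : ℝ, 0 < r → ENNReal.ofReal r < r₀ →
      ∀ c : ℝ, 0 < c → (∀ x, dist x xs = r → c < W₁ x) →
        ∃ β, IsClassKL ⊤ β ∧
          HasKLBoundFrom f D xs {x | x ∈ closure (Metric.ball xs r) ∧ W₂ x ≤ c} β) ∧
    (Tendsto W₁ (nearBoundary xs r₀) atTop →
      ∃ β, IsClassKL r₀ β ∧ HasKLBoundFrom f D xs (Metric.eball xs r₀) β) ∧
    (r₀ < ⊤ →
      Tendsto (fun x => W₁ x / (r₀.toReal ^ 2 - dist x xs ^ 2)) (nearBoundary xs r₀) atTop →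
      (∀ t, 0 ≤ t → ∀ x ∈ Metric.eball xs r₀,
        mvfderiv (𝓡 n) (fun y => dist y xs ^ 2) x (f t x) ≤ 0) →
      ∃ β, IsClassKL r₀ β ∧ HasKLBoundFrom f D xs (Metric.eball xs r₀) β) := by
  have hr₀i : r₀ ≤ injectivityRadius n xs := hr₀ ▸ inradiusAt_le_injectivityRadius hn hxs hDi
  have hr₀pos : 0 < r₀ := hr₀ ▸ inradiusAt_pos hD hxs
  have hcpt : ∀ r : ℝ, ENNReal.ofReal r < r₀ → IsCompact (Metric.closedBall xs r) := fun r hr =>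
    isCompact_closedBall_of_lt_injectivityRadius (hr.trans_le hr₀i)
  have hcD : ∀ r : ℝ, ENNReal.ofReal r < r₀ → Metric.closedBall xs r ⊆ D := fun r hr =>
    closedBall_subset_of_lt_inradiusAt (hr₀ ▸ hr)
  have heD : Metric.eball xs r₀ ⊆ D := hr₀ ▸ eball_inradiusAt_subset
  have hxse : xs ∈ Metric.eball xs r₀ := Metric.mem_eball_self hr₀pos
  have hea : ∀ x ∈ Metric.eball xs r₀, dist x xs ∈ halfOpenFromZero r₀ := fun x hx =>
    mem_eball_iff_dist_mem_halfOpenFromZero.1 hx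
  have hdist : ∀ {J : Set ℝ} {x : ℝ → M}, IsSolutionOn f D x J →
      ContinuousOn (fun t => dist (x t) xs) J := fun hx =>
    (continuous_id.dist continuous_const).comp_continuousOn hx.continuousOn
  obtain ⟨θ, hθ, hθr⟩ := exists_isClassK_unbounded hr₀pos
  have hθK : ∀ c : ℝ, ∃ K ⊆ Metric.eball xs r₀, IsCompact K ∧
      ∀ x ∈ Metric.eball xs r₀, θ (dist x xs) ≤ c → x ∈ K := fun c => by
    obtain ⟨r, hr, hrc⟩ := hθr c
    exact ⟨_, closedBall_subset_eball hr, hcpt r hr, fun x hx => hrc _ (hea x hx)⟩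
  have hGK : ∀ G : M → ℝ, Tendsto G (nearBoundary xs r₀) atTop → ∀ c : ℝ,
      ∃ K ⊆ Metric.eball xs r₀, IsCompact K ∧ ∀ x ∈ Metric.eball xs r₀, G x ≤ c → x ∈ K :=
    fun G hG c => by
      obtain ⟨r, -, hr, hrc⟩ := exists_dist_le_of_tendsto_nearBoundary hr₀pos hG c
      exact ⟨_, closedBall_subset_eball hr, hcpt r hr, hrc⟩
  refine ⟨fun r hr hrr₀ c hc hcW => ?_, fun hW => ?_, fun hfin hW hρ => ?_⟩
  · have hBD := hcD r hrr₀
    have hBc := hcpt r hrr₀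
    have hid : IsClassK ⊤ fun s => s := ⟨continuousOn_id, strictMono_id.strictMonoOn _, rfl⟩
    refine hf.exists_hasKLBoundFrom hBD (Metric.mem_closedBall_self hr.le) (hW₁.mono hBD)
      (hW₂.mono hBD) (hW₃.mono hBD) (fun _ => ⟨_, subset_rfl, hBc, fun x hx _ => hx⟩) hid
      (fun x _ => ⟨dist_nonneg, ENNReal.ofReal_lt_top⟩)
      (fun _ => ⟨_, subset_rfl, hBc, fun x hx _ => hx⟩)
      (fun t₀ ht₀ x₀ hx₀ => ?_) fun t₀ ht₀ T x hx _ => hV.exists_decay hD ht₀ hx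
    have hx₀B : x₀ ∈ Metric.closedBall xs r := Metric.closure_ball_subset_closedBall hx₀.1
    refine ⟨_, subset_rfl, hBc, hx₀B, ?_⟩
    rintro T x hx rfl t ht
    have hne : ∀ s ∈ Ico t₀ T, dist (x s) xs ≠ r := fun s hs h =>
      (hcW _ h).not_ge ((hV.lower_le hD hW₃ ht₀ hx hs).trans
        ((hV.upper t₀ ht₀ _ (hBD hx₀B)).trans hx₀.2))
    exact ((hdist hx).lt_of_forall_ne
      (lt_of_le_of_ne hx₀B (hne t₀ ⟨le_rfl, ht.1.trans_lt ht.2⟩)) hne ht).le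
  · refine hf.exists_hasKLBoundFrom heD hxse (hW₁.mono heD) (hW₂.mono heD) (hW₃.mono heD)
      (hGK _ hW) hθ hea hθK (fun t₀ ht₀ x₀ hx₀ => ?_) fun t₀ ht₀ T x hx _ =>
        hV.exists_decay hD ht₀ hx
    obtain ⟨r, hr0, hr, hrc⟩ := exists_dist_le_of_tendsto_nearBoundary hr₀pos hW (V t₀ x₀)
    obtain ⟨R, hR0, hrR, hR⟩ := ENNReal.lt_iff_exists_real_btwn.1 hr
    have hrR' : r < R := (ENNReal.ofReal_lt_ofReal_iff_of_nonneg hr0).1 hrR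
    have hx₀r := hrc x₀ hx₀ (hV.lower t₀ ht₀ _ (heD hx₀))
    refine ⟨_, closedBall_subset_eball hR, hcpt R hR, hx₀r.trans hrR'.le, ?_⟩
    rintro T x hx rfl t ht
    refine ((hdist hx).lt_of_forall_ne (hx₀r.trans_lt hrR') (fun s hs h => ?_) ht).le
    have := hrc (x s) (closedBall_subset_eball hR h.le) (hV.lower_le hD hW₃ ht₀ hx hs)
    exact (this.trans_lt hrR').ne h
  · set A := r₀.toReal ^ 2 with hA
    have hlt : ∀ {x : M}, x ∈ Metric.eball xs r₀ ↔ dist x xs ^ 2 < A := fun {x} => by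
      rw [Metric.mem_eball, edist_dist, hA, sq_lt_sq₀ dist_nonneg ENNReal.toReal_nonneg,
        ENNReal.ofReal_lt_iff_lt_toReal dist_nonneg hfin.ne]
    have hpd : ∀ {W : M → ℝ}, IsContPosDefOn W xs D →
        IsContPosDefOn (fun x => W x / (A - dist x xs ^ 2)) xs (Metric.eball xs r₀) :=
      fun {W} hW => ⟨(hW.1.mono heD).div (by fun_prop) fun x hx => (sub_pos.2 (hlt.1 hx)).ne',
        by simp [hW.2.1], fun y hy hne => div_pos (hW.2.2 y (heD hy) hne) (sub_pos.2 (hlt.1 hy))⟩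
    have hsq : ∀ {t₀ T : ℝ} {x : ℝ → M}, IsSolutionOn f D x (Ico t₀ T) → ∀ t ∈ Ico t₀ T,
        HasDerivWithinAt (fun t => dist (x t) xs ^ 2)
          (mvfderiv (𝓡 n) (fun y => dist y xs ^ 2) (x t) (f t (x t))) (Ico t₀ T) t :=
      fun {t₀ T x} hx t ht => by
        have h := (mdifferentiableAt_dist_sq (hDi (hx t ht).1)).hasDerivWithinAt_comp_curve
          (hx t ht).2
        have h1 : ((1 : ℝ →L[ℝ] ℝ).smulRight (f t (x t))) 1 = f t (x t) := one_smul ℝ _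
        rwa [h1] at h
    refine hf.exists_hasKLBoundFrom heD hxse (hpd hW₁) (hpd hW₂) (hpd hW₃)
      (hGK _ hW) hθ hea hθK (fun t₀ ht₀ x₀ hx₀ => ?_) fun t₀ ht₀ T x hx hxB => ?_
    · have hx₀r : ENNReal.ofReal (dist x₀ xs) < r₀ := (hea x₀ hx₀).2
      refine ⟨_, closedBall_subset_eball hx₀r, hcpt _ hx₀r, Metric.mem_closedBall.2 le_rfl, ?_⟩
      rintro T x hx rfl t ht
      have := le_of_hasDerivWithinAt_nonpos_of_lt (A := A) (hsq hx)
        (fun s hs h => hρ s (ht₀.trans hs.1) _ (hlt.2 h)) (hlt.1 hx₀) ht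
      exact (sq_le_sq₀ dist_nonneg dist_nonneg).1 this
    · obtain ⟨v, v', hv⟩ := hV.exists_decay hD ht₀ hx
      exact exists_decay_div hv (fun t ht => hW₁.nonneg (heD (hxB t ht))) fun t ht =>
        ⟨hsq hx t ht, hρ t (ht₀.trans ht.1) _ (hxB t ht), hlt.1 (hxB t ht)⟩
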